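/- **Setting.** Let $G$ be a finite, connected, simple graph with all degrees at least two, embedded in the plane. Let $n$ be the number of boundary edges, i.e. edge-sides $b_1,\dots,b_n$ met in a closed clockwise walk around the outer face (an edge with the outer face on both sides is counted twice). The *extended dual* of $G$ is obtained from the dual graph $G^*$ by splitting the vertex of the outer face into $n$ vertices $u_1,\dots,u_n$, where $u_i$ is the end of the dual edge crossing the side $b_i$, and by joining these in a circle by edges $u_iu_{i+1}$ (indices mod $n$). The *extended graph* is its dual: it is $G$ together with a vertex $r$ in the outer face, with one edge crossing each $u_iu_{i+1}$ and joining $r$ to the vertex $x_i$ at which $b_i$ ends and $b_{i+1}$ starts. The *extended double graph* $D$ consists of the extended graph and the extended dual, with a white vertex added at the crossing of each primal edge with its dual edge, and with $r$ and all half-edges at $r$ removed. Its black vertices are the vertices of $G$ ($\bullet$-black) and those of the extended dual ($\diamond$-black). A white vertex on an edge of $G$ has four half-edges, alternately two primal halves (to $\bullet$-black vertices) and two dual halves (to $\diamond$-black vertices); the boundary white vertex on $u_iu_{i+1}$ has three half-edges, to $u_i$, $x_i$, $u_{i+1}$ in counterclockwise order. **Local conditions** on a set $T$ of edges of $D$: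 1. At a white vertex not on the boundary, $T$ contains exactly two of the four half-edges: both primal halves, or both dual halves, or one dual half and the primal half that follows it in counterclockwise order. 2. At the boundary white vertex on $u_iu_{i+1}$, $T$ contains exactly two of the three half-edges: the one to $u_i$ and one of the other two. Fix a boundary $\diamond$-black vertex $s\in\{u_1,\dots,u_n\}$ and let $D(s)$ be $D$ with $s$ and all edges incident to it removed. An *oriented spanning tree of $D$ rooted at $s$* is a set of oriented edges without cycle in which every vertex other than $s$ has exactly one outgoing edge and $s$ has none. **Proposition.** Let $M$ be a perfect matching of $D(s)$, and let $T$ be a set of edges of $D$ that contains $M$ and satisfies conditions 1 and 2 at every white vertex of $D$. Then $T$ is the unoriented version of an oriented spanning tree of $D$ rooted at $s$ which satisfies conditions 1 and 2 and is compatible with $M$, i.e. whose edges exiting black vertices are exactly the edges of $M$. -/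

import Mathlib

namespace ExtendedDouble

/-! ### Multigraphs: perfect matchings and oriented spanning trees -/

section Multigraph

variable {α β : Type*}

/-- A perfect matching (dimer configuration): a set of edges such that every vertex is incident to
exactly one edge of the set. -/
def IsPerfectMatching (H : Graph α β) (M : Set β) : Prop :=
  M ⊆ H.edgeSet ∧ ∀ v ∈ H.vertexSet, ∃! e, e ∈ M ∧ H.Inc e v

/-- An oriented edge of `H`: an edge together with a choice of its initial vertex `src` and its
final vertex `tgt`. -/
structure OrientedEdge (H : Graph α β) where
  edge : β
  src : α
  tgt : α
  isLink : H.IsLink edge src tgt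

/-- The unoriented version of a set of oriented edges. -/
def unoriented {H : Graph α β} (O : Set (OrientedEdge H)) : Set β :=
  OrientedEdge.edge '' O

/-- One step along an oriented edge of `O`. -/
def Step {H : Graph α β} (O : Set (OrientedEdge H)) (x y : α) : Prop :=
  ∃ a ∈ O, a.src = x ∧ a.tgt = y

/-- `O` is an oriented spanning tree of `H` rooted at `s`: every vertex except `s` has exactly one
outgoing edge in `O`, the root has none, and `O` contains no oriented cycle. (Since out-degrees
are at most one, any cycle of the unoriented version would be an oriented cycle.) -/
structure IsOST (H : Graph α β) (s : α) (O : Set (OrientedEdge H)) : Prop where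
  root_mem : s ∈ H.vertexSet
  exists_unique_out : ∀ v ∈ H.vertexSet, v ≠ s → ∃! a, a ∈ O ∧ a.src = v
  root_no_out : ∀ a ∈ O, a.src ≠ s
  no_cycle : ∀ v, ¬ Relation.TransGen (Step O) v v

end Multigraph

/-! ### Plane graphs as combinatorial maps -/

variable {V : Type*}

/-- Reversal of darts (oriented edges) of a simple graph, as a permutation. -/
def dartRev (G : SimpleGraph V) : Equiv.Perm G.Dart :=
  Function.Involutive.toPerm SimpleGraph.Dart.symm SimpleGraph.Dart.symm_involutive

/-- If `rot` sends each dart to the next dart in counterclockwise order around its initial vertex,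
then `facePerm rot` sends each dart to the next dart along the face on its left: reverse the dart,
then take the next dart in clockwise order. -/
def facePerm {G : SimpleGraph V} (rot : Equiv.Perm G.Dart) : Equiv.Perm G.Dart :=
  (dartRev G).trans rot.symm

/-- The faces of a rotation system: the cycles of the face permutation. -/
abbrev FaceOf {G : SimpleGraph V} (rot : Equiv.Perm G.Dart) : Type _ :=
  Quotient (Equiv.Perm.SameCycle.setoid (facePerm rot))

/-- An embedding in the plane of a finite connected simple graph with at least one edge, up to
orientation-preserving homeomorphism: a rotation system of genus `0` (Euler's formula for the
sphere), with one face chosen as the outer one. -/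
structure PlaneEmbedding (G : SimpleGraph V) where
  /-- the next dart counterclockwise around the initial vertex -/
  rot : Equiv.Perm G.Dart
  rot_fst : ∀ d, (rot d).fst = d.fst
  rot_cyclic : ∀ d d' : G.Dart, d.fst = d'.fst → rot.SameCycle d d'
  connected : G.Connected
  euler : Nat.card V + Nat.card (FaceOf rot) = Nat.card G.edgeSet + 2
  /-- the outer (unbounded) face -/
  outer : FaceOf rot

namespace PlaneEmbedding

variable {G : SimpleGraph V} (P : PlaneEmbedding G)

/-- The next dart along the face on the left. -/
def next : Equiv.Perm G.Dart := facePerm P.rot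

/-- The face on the left of a dart. -/
def leftFace (d : G.Dart) : FaceOf P.rot := Quotient.mk _ d

theorem leftFace_next (d : G.Dart) : P.leftFace (P.next d) = P.leftFace d :=
  Quotient.sound (Equiv.Perm.sameCycle_apply_left.mpr (Equiv.Perm.SameCycle.refl _ _))

/-- The boundary darts: those with the outer face on their left. They are the edges of the closed
boundary walk of the outer face, traversed clockwise as seen from the inside; an edge with the
outer face on both sides occurs twice. -/
def BoundaryDart : Type _ := {d : G.Dart // P.leftFace d = P.outer}

/-- The next boundary dart, clockwise along the boundary. -/
def nextB (b : P.BoundaryDart) : P.BoundaryDart :=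
  ⟨P.next b.1, (P.leftFace_next b.1).trans b.2⟩

/-! ### The extended double graph

The vertex of the dual graph placed in the outer face is split into one vertex for each boundary
dart, and these are joined circularly; this is the extended dual. The extended graph, dual to it,
has an additional vertex `r` joined to the terminal vertex of each boundary dart `b`, by an edge
crossing the circular edge from the vertex of `b` to that of `nextB b`. The extended double graph
has the vertices of both graphs except `r`, a white vertex at each crossing of a primal edge with
its dual, and the resulting half-edges not containing `r`. -/

/-- Vertices of the extended double graph. -/
inductive Vert : Type _
  /-- `•`-black: vertices of the graph -/
  | primal (v : V)
  /-- `◇`-black, inner: faces other than the outer one -/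
  | innerDual (f : {f : FaceOf P.rot // f ≠ P.outer})
  /-- `◇`-black, boundary: vertices obtained by splitting the outer dual vertex -/
  | boundaryDual (b : P.BoundaryDart)
  /-- white, not on the boundary: crossing of an edge of the graph with its dual -/
  | white (e : G.edgeSet)
  /-- white, on the boundary: crossing of the circular edge from `b` to `nextB b` with the edge
  from the terminal vertex of `b` to `r` -/
  | boundaryWhite (b : P.BoundaryDart)

/-- Edges of the extended double graph. -/
inductive Edge : Type _
  /-- half of a primal edge, at the initial vertex of `d` -/
  | primalHalf (d : G.Dart)
  /-- half of a dual edge, on the left of `d` -/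
  | dualHalf (d : G.Dart)
  /-- first half of the circular edge from `b` to `nextB b` -/
  | backHalf (b : P.BoundaryDart)
  /-- second half of the circular edge from `b` to `nextB b` -/
  | frontHalf (b : P.BoundaryDart)
  /-- half of the edge to `r` from the terminal vertex of `b` -/
  | spoke (b : P.BoundaryDart)

open Classical in
/-- The vertex of the extended dual on the left of a dart. -/
noncomputable def leftDual (d : G.Dart) : P.Vert :=
  if h : P.leftFace d = P.outer then .boundaryDual ⟨d, h⟩ else .innerDual ⟨P.leftFace d, h⟩

/-- The black end of an edge. -/
noncomputable def blackEnd : P.Edge → P.Vert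
  | .primalHalf d => .primal d.fst
  | .dualHalf d => P.leftDual d
  | .backHalf b => .boundaryDual b
  | .frontHalf b => .boundaryDual (P.nextB b)
  | .spoke b => .primal b.1.snd

/-- The white end of an edge. -/
def whiteEnd : P.Edge → P.Vert
  | .primalHalf d => .white ⟨d.edge, d.edge_mem⟩
  | .dualHalf d => .white ⟨d.edge, d.edge_mem⟩
  | .backHalf b => .boundaryWhite b
  | .frontHalf b => .boundaryWhite b
  | .spoke b => .boundaryWhite b

/-- The black vertices, of both kinds `•` and `◇`. -/
def IsBlack : P.Vert → Prop
  | .primal _ => True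
  | .innerDual _ => True
  | .boundaryDual _ => True
  | .white _ => False
  | .boundaryWhite _ => False

/-- The extended double graph. It is a multigraph: the two halves of a dual edge are parallel when
the primal edge has the same inner face on both sides. -/
def doubleGraph : Graph P.Vert P.Edge where
  vertexSet := Set.univ
  IsLink e x y := (x = P.blackEnd e ∧ y = P.whiteEnd e) ∨ (x = P.whiteEnd e ∧ y = P.blackEnd e)
  isLink_symm := fun _ _ => ⟨fun _ _ h => h.elim (fun h => Or.inr ⟨h.2, h.1⟩)
    (fun h => Or.inl ⟨h.2, h.1⟩)⟩
  eq_or_eq_of_isLink_of_isLink := by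
    rintro e x y v w (⟨rfl, rfl⟩ | ⟨rfl, rfl⟩) (⟨rfl, rfl⟩ | ⟨rfl, rfl⟩) <;> simp
  left_mem_of_isLink := fun _ _ _ _ => Set.mem_univ _

/-- The extended double graph with a vertex `s` and all edges incident to it removed. -/
def doubleGraphMinus (s : P.Vert) : Graph P.Vert P.Edge := P.doubleGraph.deleteVerts {s}

/-- The restriction of an edge configuration around a vertex. -/
def around (T : Set P.Edge) (w : P.Vert) : Set P.Edge := {e ∈ T | P.doubleGraph.Inc e w}

/-- The local condition at the white vertex on the edge underlying `d`. Around this vertex the four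
half-edges are, in counterclockwise order, `primalHalf d.symm`, `dualHalf d`, `primalHalf d`,
`dualHalf d.symm`. The allowed configurations are: both primal halves; both dual halves; one dual
half together with the primal half following it counterclockwise, so that a path entering
through the dual half and leaving through the primal half turns right. -/
def LocalInner (T : Set P.Edge) (d : G.Dart) : Prop :=
  P.around T (.white ⟨d.edge, d.edge_mem⟩) = {.primalHalf d, .primalHalf d.symm} ∨
  P.around T (.white ⟨d.edge, d.edge_mem⟩) = {.dualHalf d, .dualHalf d.symm} ∨
  P.around T (.white ⟨d.edge, d.edge_mem⟩) = {.dualHalf d, .primalHalf d} ∨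
  P.around T (.white ⟨d.edge, d.edge_mem⟩) = {.dualHalf d.symm, .primalHalf d.symm}

/-- The local condition at a boundary white vertex. Around it the three half-edges are, in
counterclockwise order, `backHalf b`, `spoke b`, `frontHalf b`. The allowed configurations consist
of `backHalf b` and one of the other two half-edges. -/
def LocalBoundary (T : Set P.Edge) (b : P.BoundaryDart) : Prop :=
  P.around T (.boundaryWhite b) = {.backHalf b, .frontHalf b} ∨
  P.around T (.boundaryWhite b) = {.backHalf b, .spoke b}

/-- The local conditions at all white vertices. -/
def SatisfiesLocal (T : Set P.Edge) : Prop :=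
  (∀ d, P.LocalInner T d) ∧ ∀ b, P.LocalBoundary T b

/-- The edges of an oriented configuration that exit black vertices. -/
def blackOut (O : Set (OrientedEdge P.doubleGraph)) : Set P.Edge :=
  {e | ∃ a ∈ O, P.IsBlack a.src ∧ a.edge = e}

/-- Oriented spanning trees of the extended double graph rooted at `s`, satisfying the local
conditions at every white vertex, and compatible with `M`. -/
def IsCompatibleOST (s : P.Vert) (M : Set P.Edge) (O : Set (OrientedEdge P.doubleGraph)) : Prop :=
  IsOST P.doubleGraph s O ∧ P.SatisfiesLocal (unoriented O) ∧ P.blackOut O = M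

end PlaneEmbedding

end ExtendedDouble

/-! Orient the edges of `M` from black to white and those of `T \ M` from white to black. At each
white vertex `T` has two edges and `M` exactly one, so every vertex except `s` has exactly one
outgoing edge; the substance is the absence of oriented cycles. An oriented cycle is simple and
alternates between `M` and `T \ M`, with `K` edges of each sort. As the map has genus zero, the
cycle bounds a region that avoids the outer face. Let `F` be the number of quadrangles in this
region. Two counts of `F + K` modulo 2 contradict each other.

Euler's formula: the closed region has `F + K + 1` vertices. `M` matches its black vertices with its
white ones: those on the cycle along the cycle, the interior ones inside the region, where `s`
cannot be because it lies on the outer face. So the number of vertices is even and `F + K` is odd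
(`even_of_region`, `ncard_blackEnd_image_eq_ncard_whiteEnd_image`).

Corners: the quadrangles have `2F` corners at white vertices. An interior white vertex carries four
of them. Where the cycle, run with the region on its left, passes a white vertex, the local
conditions make it turn right from dual to primal and left from primal to dual, so that the number
of corners inside is `2 + kind(out) - kind(in)`, with kind `1` for primal and `0` for dual. The
kinds cancel around the cycle, hence `2F = 2K` modulo 4 and `F + K` is even (`sum_sectorWeight`).

The topology is expressed by permutations of the edges: `σ` and `τ` rotate around black and white
ends, `τ ∘ σ` turns around faces, and a region is a pair `A`, `B` of sets of edges with the region
on their left or right, seen from the black end. That a cycle bounds is the vanishing of the first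
homology modulo 2, deduced from Euler's formula by counting dimensions (`exists_coloring_of_cycle`);
Euler's formula for the region is needed only modulo 2 and follows from signs of permutations. -/

namespace ExtendedDouble

open Equiv Equiv.Perm

/-! ### Signs of permutations from their orbits -/

section PermSign

variable {X Y : Type*} [Fintype X] [DecidableEq X]

/-- A permutation with a single orbit has the sign of a full cycle. -/
theorem sign_of_forall_sameCycle [Nonempty X] (c : Perm X) (h : ∀ x y, c.SameCycle x y) :
    sign c = -(-1) ^ Fintype.card X := by
  rcases subsingleton_or_nontrivial X with hX | hX
  · have h1 : c = 1 := Subsingleton.elim _ _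
    have h2 : Fintype.card X = 1 := Fintype.card_eq_one_iff_nonempty_unique.2
      ⟨⟨⟨Classical.arbitrary X⟩, fun _ => Subsingleton.elim _ _⟩⟩
    rw [h1, h2]; simp
  · have hne : ∀ x, c x ≠ x := by
      intro x hx
      obtain ⟨y, hy⟩ := exists_ne x
      exact hy ((h x y).eq_of_left hx).symm
    have hc : c.IsCycle :=
      ⟨Classical.arbitrary X, hne _, fun y _ => h _ y⟩
    have hs : c.support = Finset.univ := by ext x; simp [hne x]
    rw [hc.sign, hs, Finset.card_univ]

/-- The sign of a permutation whose orbits are the fibres of a surjection. -/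
theorem sign_of_orbits_eq_fibers [Fintype Y] (σ : Perm X) (g : X → Y)
    (hg : Function.Surjective g) (hinv : ∀ x, g (σ x) = g x)
    (htrans : ∀ x y, g x = g y → σ.SameCycle x y) :
    sign σ = (-1) ^ (Fintype.card X + Fintype.card Y) := by
  classical
  have hp : ∀ s : Finset Y, ∀ x, g (σ x) ∈ s ↔ g x ∈ s := fun s x => by rw [hinv]
  have onMem : ∀ (s : Finset Y) x, g x ∈ s →
      ofSubtype (σ.subtypePerm (p := fun x => g x ∈ s) (hp s)) x = σ x := fun s x hx => by
    rw [ofSubtype_apply_of_mem (p := fun x => g x ∈ s) _ hx]; rfl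
  have offMem : ∀ (s : Finset Y) x, g x ∉ s →
      ofSubtype (σ.subtypePerm (p := fun x => g x ∈ s) (hp s)) x = x := fun s x hx =>
    ofSubtype_apply_of_not_mem (p := fun x => g x ∈ s) _ hx
  -- Build `σ` one orbit at a time: on the fibres over `s` it is a product of disjoint cycles, each
  -- with sign given by `sign_of_forall_sameCycle`.
  have key : ∀ s : Finset Y, sign (ofSubtype (σ.subtypePerm (p := fun x => g x ∈ s) (hp s))) =
      (-1) ^ ((Finset.univ.filter fun x => g x ∈ s).card + s.card) := by
    intro s
    induction s using Finset.induction_on with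
    | empty =>
      have : ofSubtype (σ.subtypePerm (p := fun x => g x ∈ (∅ : Finset Y)) (hp ∅)) = 1 := by
        ext x
        rw [ofSubtype_apply_of_not_mem _ (by simp)]; rfl
      rw [this]; simp
    | insert y s hy ih =>
      have hmul : ofSubtype (σ.subtypePerm (p := fun x => g x ∈ insert y s) (hp (insert y s))) =
          ofSubtype (σ.subtypePerm (p := fun x => g x ∈ s) (hp s)) *
            ofSubtype (σ.subtypePerm (p := fun x => g x ∈ ({y} : Finset Y)) (hp {y})) := by
        ext x
        rw [Perm.mul_apply]
        by_cases hxy : g x = y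
        · rw [onMem (insert y s) x (by simp [hxy]), onMem {y} x (by simp [hxy]),
            offMem s (σ x) (by rwa [hinv, hxy])]
        · rw [offMem {y} x (by simp [hxy])]
          by_cases hxs : g x ∈ s
          · rw [onMem (insert y s) x (by simp [hxs]), onMem s x hxs]
          · rw [offMem (insert y s) x (by simp [hxs, hxy]), offMem s x hxs]
      obtain ⟨x₀, hx₀⟩ := hg y
      have hne : Nonempty {x // g x ∈ ({y} : Finset Y)} := ⟨⟨x₀, by simp [hx₀]⟩⟩
      have hsing : sign (σ.subtypePerm (p := fun x => g x ∈ ({y} : Finset Y)) (hp {y})) =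
          -(-1) ^ Fintype.card {x // g x ∈ ({y} : Finset Y)} := by
        apply sign_of_forall_sameCycle
        rintro ⟨a, ha⟩ ⟨b, hb⟩
        rw [sameCycle_subtypePerm]
        apply htrans
        simp only [Finset.mem_singleton] at ha hb
        simp [ha, hb]
      rw [hmul, map_mul, ih,
        sign_ofSubtype (σ.subtypePerm (p := fun x => g x ∈ ({y} : Finset Y)) (hp {y})), hsing,
        Fintype.card_subtype,
        Finset.card_insert_of_notMem hy]
      have hcard : (Finset.univ.filter fun x => g x ∈ insert y s).card =
          (Finset.univ.filter fun x => g x ∈ s).card +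
            (Finset.univ.filter fun x => g x ∈ ({y} : Finset Y)).card := by
        rw [← Finset.card_union_of_disjoint]
        · congr 1
          ext x
          simp [or_comm]
        · rw [Finset.disjoint_filter]
          intro x _ h1 h2
          simp only [Finset.mem_singleton] at h2
          exact hy (h2 ▸ h1)
      rw [hcard]
      simp only [pow_add, pow_one]
      rw [neg_eq_neg_one_mul ((-1 : ℤˣ) ^ _)]
      simp only [mul_assoc, mul_comm, mul_left_comm]
  have := key Finset.univ
  have h1 : ofSubtype (σ.subtypePerm (p := fun x => g x ∈ Finset.univ) (hp Finset.univ)) = σ := by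
    ext x
    rw [ofSubtype_apply_of_mem _ (by simp)]; rfl
  rw [h1] at this
  simpa using this

/-- The sign of a fixed-point free involution. -/
theorem sign_of_involution (σ : Perm X) (h2 : ∀ x, σ (σ x) = x) (h1 : ∀ x, σ x ≠ x) :
    sign σ = (-1) ^ (Fintype.card X / 2) := by
  have hσ : σ ^ 2 = 1 := by ext x; simp [pow_two, h2]
  have hf : IsEmpty (Function.fixedPoints σ) := ⟨fun x => h1 x.1 x.2⟩
  rw [sign_of_pow_two_eq_one hσ, Fintype.card_eq_zero (α := Function.fixedPoints σ)]
  simp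

end PermSign

/-! ### Cutting a rotation along the boundary of a region -/

section CapPerm

variable {X : Type*} [Finite X]

open Classical in
/-- Given a permutation `σ` and sets with `σ x ∈ B ↔ x ∈ A`, the permutation of `A ∪ B` that is `σ`
on `A` and a given bijection `B \ A ≃ A \ B` on the rest. -/
noncomputable def capPerm (σ : Perm X) (A B : Set X) (h : ∀ x, σ x ∈ B ↔ x ∈ A)
    (j : ↥(B \ A) ≃ ↥(A \ B)) : Perm ↥(A ∪ B) :=
  Equiv.ofBijective (fun x => if hx : x.1 ∈ A then ⟨σ x.1, Or.inr ((h _).2 hx)⟩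
      else ⟨(j ⟨x.1, x.2.resolve_left hx, hx⟩).1, Or.inl (j _).2.1⟩) <| by
    rw [← Finite.injective_iff_bijective]
    rintro ⟨x, hx⟩ ⟨y, hy⟩ hxy
    by_cases hxA : x ∈ A <;> by_cases hyA : y ∈ A <;>
      simp only [hxA, hyA, dite_true, dite_false] at hxy <;>
      replace hxy := congrArg Subtype.val hxy <;> simp only at hxy
    · exact Subtype.ext (σ.injective hxy)
    · exact ((j ⟨y, hy.resolve_left hyA, hyA⟩).2.2 (hxy ▸ (h x).2 hxA)).elim
    · exact ((j ⟨x, hx.resolve_left hxA, hxA⟩).2.2 (hxy ▸ (h y).2 hyA)).elim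
    · simpa [Subtype.ext_iff] using j.injective (Subtype.ext hxy)

variable {σ : Perm X} {A B : Set X} {h : ∀ x, σ x ∈ B ↔ x ∈ A} {j : ↥(B \ A) ≃ ↥(A \ B)}

theorem capPerm_apply_of_mem (x : ↥(A ∪ B)) (hx : x.1 ∈ A) :
    (capPerm σ A B h j x).1 = σ x.1 := by
  simp [capPerm, hx]

theorem capPerm_apply_of_notMem (x : ↥(A ∪ B)) (hx : x.1 ∉ A) :
    (capPerm σ A B h j x).1 = j ⟨x.1, x.2.resolve_left hx, hx⟩ := by
  simp [capPerm, hx]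

/-- If every orbit of `σ` contains at most one element of `B \ A`, and the given bijection preserves
orbits, then the orbits of `capPerm` are the intersections of those of `σ` with `A ∪ B`. -/
theorem sameCycle_capPerm {Y : Type*} (f : X → Y) (hf : ∀ x, f (σ x) = f x)
    (hcyc : ∀ x y, f x = f y → σ.SameCycle x y)
    (huniq : ∀ x ∈ B \ A, ∀ y ∈ B \ A, f x = f y → x = y)
    (x y : ↥(A ∪ B)) (hxy : f x.1 = f y.1) : (capPerm σ A B h j).SameCycle x y := by
  -- The capped permutation follows `σ` as long as the current element is in `A`. So the walk from
  -- `x` reaches `y` or stops at an element of `B \ A`; if the walks from `x` and from `y` both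
  -- stop, uniqueness makes them stop at the same place.
  have reach : ∀ (n : ℕ) (x y : ↥(A ∪ B)), (σ ^ n) x.1 = y.1 →
      ((∃ z : ↥(A ∪ B), z.1 ∉ A ∧ f z = f x ∧ (capPerm σ A B h j).SameCycle x z) ∨
        (capPerm σ A B h j).SameCycle x y) := by
    intro n
    induction n with
    | zero =>
      intro x y hn
      right
      have : x = y := Subtype.ext (by simpa using hn)
      rw [this]
    | succ n ih =>
      intro x y hn
      by_cases hxA : x.1 ∈ A
      · have hx' := capPerm_apply_of_mem (h := h) (j := j) x hxA
        have := ih (capPerm σ A B h j x) y (by rw [hx']; simpa [pow_succ] using hn)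
        rw [sameCycle_apply_left, hx', hf] at this
        rcases this with ⟨z, hz, hzf, hzs⟩ | h'
        · exact Or.inl ⟨z, hz, hzf, by rwa [sameCycle_apply_left] at hzs⟩
        · exact Or.inr h'
      · exact Or.inl ⟨x, hxA, rfl, SameCycle.refl _ _⟩
  have exn : ∀ x y : ↥(A ∪ B), f x.1 = f y.1 → ∃ n : ℕ, (σ ^ n) x.1 = y.1 := by
    intro x y hxy
    cases nonempty_fintype X
    classical
    obtain ⟨n, -, hn⟩ := (hcyc _ _ hxy).exists_pow_eq'
    exact ⟨n, hn⟩
  obtain ⟨n, hn⟩ := exn x y hxy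
  obtain ⟨m, hm⟩ := exn y x hxy.symm
  rcases reach n x y hn with ⟨z, hz, hzf, hzs⟩ | h1
  · rcases reach m y x hm with ⟨w, hw, hwf, hws⟩ | h2
    · have : z = w := Subtype.ext (huniq _ ⟨z.2.resolve_left hz, hz⟩ _ ⟨w.2.resolve_left hw, hw⟩
        (hzf.trans (hxy.trans hwf.symm)))
      exact hzs.trans (this ▸ hws.symm)
    · exact h2.symm
  · exact h1

/-- By `sameCycle_capPerm` the orbits are the nonempty fibres of `f` on `A ∪ B`, one for each vertex
of the closed region, so the sign counts these vertices. -/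
theorem sign_capPerm [Fintype ↥(A ∪ B)] [DecidableEq ↥(A ∪ B)] {Y : Type*} (f : X → Y)
    (hf : ∀ x, f (σ x) = f x)
    (hcyc : ∀ x y, f x = f y → σ.SameCycle x y)
    (huniq : ∀ x ∈ B \ A, ∀ y ∈ B \ A, f x = f y → x = y)
    (hj : ∀ x, f (j x) = f x) :
    sign (capPerm σ A B h j) = (-1) ^ (Fintype.card ↥(A ∪ B) + (f '' (A ∪ B)).ncard) := by
  classical
  have : Fintype ↥(f '' (A ∪ B)) := Fintype.ofFinite _
  rw [sign_of_orbits_eq_fibers (capPerm σ A B h j)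
    (fun x => (⟨f x.1, Set.mem_image_of_mem _ x.2⟩ : ↥(f '' (A ∪ B))))]
  · rw [← Nat.card_coe_set_eq, Nat.card_eq_fintype_card]
  · rintro ⟨_, x, hx, rfl⟩
    exact ⟨⟨x, hx⟩, rfl⟩
  · intro x
    apply Subtype.ext
    by_cases hxA : x.1 ∈ A
    · simp only [capPerm_apply_of_mem x hxA, hf]
    · simp only [capPerm_apply_of_notMem x hxA, hj]
  · intro x y hxy
    exact sameCycle_capPerm f hf hcyc huniq x y (congrArg Subtype.val hxy)

end CapPerm

/-! ### Walking along orbits and cycles -/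

section Orbits

variable {X : Type*}

theorem exists_pow_eq_of_sameCycle [Finite X] {σ : Perm X} {x y : X} (h : σ.SameCycle x y) :
    ∃ n : ℕ, (σ ^ n) x = y := by
  cases nonempty_fintype X
  classical
  obtain ⟨n, -, hn⟩ := h.exists_pow_eq'
  exact ⟨n, hn⟩

theorem rel_of_sameCycle [Finite X] {σ : Perm X} {r : X → X → Prop} (hrefl : ∀ x, r x x)
    (hstep : ∀ x y, r x y → r x (σ y)) {x y : X} (h : σ.SameCycle x y) : r x y := by
  obtain ⟨n, rfl⟩ := exists_pow_eq_of_sameCycle h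
  induction n with
  | zero => exact hrefl x
  | succ n ih =>
    rw [pow_succ']
    exact hstep _ _ (ih ⟨n, by simp⟩)

/-- If an indicator changes along `σ` exactly at the elements of `C`, and an orbit of `σ` contains
just two elements of `C`, then the indicator differs at these two. -/
theorem mem_iff_notMem_of_two_jumps [Finite X] (σ : Perm X) (A C : Set X)
    (hC : ∀ x, x ∈ C ↔ ¬ (σ x ∈ A ↔ x ∈ A)) {e e' : X} (he : e ∈ C) (hne : e ≠ e')
    (hcyc : σ.SameCycle e e') (huniq : ∀ x ∈ C, σ.SameCycle e x → x = e ∨ x = e') :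
    e' ∈ A ↔ e ∉ A := by
  classical
  have hex := exists_pow_eq_of_sameCycle hcyc
  obtain ⟨m, hm⟩ : ∃ m, Nat.find hex = m + 1 := by
    apply Nat.exists_eq_succ_of_ne_zero
    intro h0
    have := Nat.find_spec hex
    rw [h0] at this
    exact hne (by simpa using this)
  -- The indicator flips on leaving `e` and is then constant until the first visit to `e'`, since no
  -- element of `C` is met in between.
  have claim : ∀ i ≤ m, ((σ ^ (i + 1)) e ∈ A ↔ e ∉ A) := by
    intro i
    induction i with
    | zero =>
      intro _
      have := (hC e).1 he
      simp only [zero_add, pow_one]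
      tauto
    | succ i ih =>
      intro hi
      have h1 := ih (by omega)
      have h2 : (σ ^ (i + 1)) e ∉ C := by
        intro hc
        rcases huniq _ hc ⟨((i + 1 : ℕ) : ℤ), by rw [zpow_natCast]⟩ with h | h
        · rw [h] at h1; tauto
        · exact Nat.find_min hex (m := i + 1) (by omega) h
      rw [hC, not_not] at h2
      rw [pow_succ', Perm.mul_apply, h2, h1]
  have hfind := Nat.find_spec hex
  rw [hm] at hfind
  rw [← hfind]
  exact claim m le_rfl

/-- A cycle of a right-unique relation on a finite type. -/
theorem exists_cycle_of_transGen [Finite X] {r : X → X → Prop} (hr : Relator.RightUnique r) {a : X}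
    (ha : Relation.TransGen r a a) :
    ∃ (K : Set X) (π : Perm K), a ∈ K ∧ (∀ k : K, r k (π k)) ∧ ∀ x y : K, π.SameCycle x y := by
  let K : Set X := {x | Relation.ReflTransGen r a x}
  have hback : ∀ x ∈ K, ∃ y ∈ K, r y x := by
    intro x hx
    have : Relation.TransGen r a x := by
      rcases Relation.reflTransGen_iff_eq_or_transGen.1 hx with h | h
      · exact h ▸ ha
      · exact h
    obtain ⟨y, hy, hyx⟩ := Relation.TransGen.tail'_iff.1 this
    exact ⟨y, hy, hyx⟩
  -- By right uniqueness, a path from `a` can never leave the cycle, so everything reachable from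
  -- `a` leads back to it.
  have hreach : ∀ x ∈ K, Relation.TransGen r x a := by
    intro x hx
    induction hx with
    | refl => exact ha
    | tail _ h ih =>
      obtain ⟨z, hz, hza⟩ := Relation.TransGen.head'_iff.1 ih
      rw [hr h hz]
      rcases Relation.reflTransGen_iff_eq_or_transGen.1 hza with h' | h'
      · exact h' ▸ ha
      · exact h'
  have hfwd : ∀ x : K, ∃ y : K, r x y := by
    intro x
    obtain ⟨z, hz, -⟩ := Relation.TransGen.head'_iff.1 (hreach x x.2)
    exact ⟨⟨z, Relation.ReflTransGen.tail x.2 hz⟩, hz⟩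
  choose g hg using hfwd
  have hsurj : Function.Surjective g := by
    intro x
    obtain ⟨y, hy, hyx⟩ := hback x x.2
    exact ⟨⟨y, hy⟩, Subtype.ext (hr (hg _) hyx)⟩
  let π : Perm K := Equiv.ofBijective g (Finite.surjective_iff_bijective.1 hsurj)
  have hfrom : ∀ (x : X) (hx : x ∈ K), π.SameCycle ⟨a, Relation.ReflTransGen.refl⟩ ⟨x, hx⟩ := by
    intro x hx
    induction hx with
    | refl => exact SameCycle.refl _ _
    | @tail b c hb h ih =>
      have : π ⟨b, hb⟩ = ⟨c, Relation.ReflTransGen.tail hb h⟩ := Subtype.ext (hr (hg _) h)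
      rw [← this, sameCycle_apply_right]
      exact ih
  exact ⟨K, π, Relation.ReflTransGen.refl, hg,
    fun x y => (hfrom x x.2).symm.trans (hfrom y y.2)⟩

end Orbits

/-! ### Euler's formula modulo 2 for a region -/

section Region

variable {X : Type*} [Finite X]

/-- A parity form of Euler's formula for a disc. Let `σ` and `τ` be the rotations around the black
and around the white vertices of a bipartite map, `A` the set of edges having the region on their
left, `B` that of edges having it on their right. If the boundary of the region is a single simple
cycle and its faces are quadrangles, then the number of its vertices, faces, and half the
length of the boundary have odd sum. -/
theorem even_of_region (σ τ : Perm X) (A B : Set X) (hσ : ∀ x, σ x ∈ B ↔ x ∈ A)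
    (hτ : ∀ x, τ x ∈ A ↔ x ∈ B) {K : Type*} [Finite K] [Nonempty K] (ι κ : K → X)
    (hιi : Function.Injective ι) (hκi : Function.Injective κ)
    (hι : Set.range ι = A \ B) (hκ : Set.range κ = B \ A)
    (π : Perm K) (hπ : ∀ x y, π.SameCycle x y) {Y Z : Type*} (f : X → Y) (g : X → Z)
    (hf : ∀ x, f (σ x) = f x) (hfc : ∀ x y, f x = f y → σ.SameCycle x y)
    (hg : ∀ x, g (τ x) = g x) (hgc : ∀ x y, g x = g y → τ.SameCycle x y)
    (hfK : ∀ k, f (κ k) = f (ι (π k))) (hgK : ∀ k, g (κ k) = g (ι k))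
    (hfi : Function.Injective (f ∘ κ)) (hgi : Function.Injective (g ∘ ι))
    (hinv : ∀ x ∈ A, τ (σ (τ (σ x))) = x) (hfix : ∀ x ∈ A, τ (σ x) ≠ x) :
    Even ((f '' (A ∪ B)).ncard + (g '' (A ∪ B)).ncard + A.ncard / 2 + Nat.card K + 1) := by
  classical
  cases nonempty_fintype X
  cases nonempty_fintype K
  let eι : K ≃ ↥(A \ B) := (Equiv.ofInjective ι hιi).trans (Equiv.setCongr hι)
  let eκ : K ≃ ↥(B \ A) := (Equiv.ofInjective κ hκi).trans (Equiv.setCongr hκ)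
  have eι_apply : ∀ k, (eι k : X) = ι k := fun k => rfl
  have eκ_apply : ∀ k, (eκ k : X) = κ k := fun k => rfl
  -- The caps jump over the complement of the region at a boundary vertex: from `κ k` to `ι (π k)`
  -- at a black one, from `ι k` to `κ k` at a white one.
  let j : ↥(B \ A) ≃ ↥(A \ B) := eκ.symm.trans (π.trans eι)
  let j' : ↥(A \ B) ≃ ↥(B \ A) := eι.symm.trans eκ
  let S := capPerm σ A B hσ j
  let R := capPerm τ B A hτ j'
  let e : ↥(B ∪ A) ≃ ↥(A ∪ B) := Equiv.setCongr (Set.union_comm B A)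
  have hS : sign S = (-1) ^ (Fintype.card ↥(A ∪ B) + (f '' (A ∪ B)).ncard) := by
    apply sign_capPerm f hf hfc
    · rw [← hκ]
      rintro _ ⟨k, rfl⟩ _ ⟨l, rfl⟩ h
      rw [hfi h]
    · intro x
      obtain ⟨k, rfl⟩ := eκ.surjective x
      simp [j, eκ_apply, eι_apply, hfK]
  have hR : sign R = (-1) ^ (Fintype.card ↥(A ∪ B) + (g '' (A ∪ B)).ncard) := by
    rw [Fintype.card_congr e.symm, Set.union_comm A B]
    apply sign_capPerm g hg hgc
    · rw [← hι]
      rintro _ ⟨k, rfl⟩ _ ⟨l, rfl⟩ h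
      rw [hgi h]
    · intro x
      obtain ⟨k, rfl⟩ := eι.surjective x
      simp [j', eκ_apply, eι_apply, hgK]
  -- The face permutation of the capped region: on `A` it exchanges the two edges of each
  -- quadrangle, and on `B \ A` it runs once around the boundary. Comparing this sign with that of
  -- the two rotations gives the parity.
  let F : Perm ↥(A ∪ B) := e.permCongr R * S
  have hF : sign F = (-1) ^ ((f '' (A ∪ B)).ncard + (g '' (A ∪ B)).ncard) := by
    have h2 : ∀ a b c : ℕ, (-1 : ℤˣ) ^ (a + b) * (-1) ^ (a + c) = (-1) ^ (c + b) := by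
      intro a b c
      rw [← pow_add, show a + b + (a + c) = 2 * a + (c + b) by ring, pow_add _ (2 * a), pow_mul]
      simp
    simp only [F, map_mul]
    rw [sign_permCongr, hS, hR, h2]
  have hFA : ∀ x, x.1 ∈ A → (F x).1 = τ (σ x.1) := by
    intro x hx
    have h1 := capPerm_apply_of_mem (h := hσ) (j := j) x hx
    have h2 := capPerm_apply_of_mem (h := hτ) (j := j') (e.symm (S x))
      (by change (S x).1 ∈ B; rw [h1]; exact (hσ _).2 hx)
    change (R (e.symm (S x))).1 = _
    rw [h2]
    change τ (S x).1 = _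
    rw [h1]
  have hκB : ∀ k, κ k ∈ B \ A := fun k => hκ ▸ Set.mem_range_self k
  have hFK : ∀ k, F ⟨κ k, Or.inr (hκB k).1⟩ = ⟨κ (π k), Or.inr (hκB _).1⟩ := by
    intro k
    have h1 : (S ⟨κ k, Or.inr (hκB k).1⟩).1 = ι (π k) := by
      rw [capPerm_apply_of_notMem (h := hσ) (j := j) ⟨κ k, Or.inr (hκB k).1⟩ (hκB k).2]
      have : (⟨κ k, hκB k⟩ : ↥(B \ A)) = eκ k := rfl
      simp only [j, this]
      simp [eι_apply]
    have hιA : ι (π k) ∈ A \ B := hι ▸ Set.mem_range_self _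
    have h2 := capPerm_apply_of_notMem (h := hτ) (j := j')
      (e.symm (S ⟨κ k, Or.inr (hκB k).1⟩))
      (by change (S ⟨κ k, Or.inr (hκB k).1⟩).1 ∉ B; rw [h1]; exact hιA.2)
    apply Subtype.ext
    change (R (e.symm (S ⟨κ k, Or.inr (hκB k).1⟩))).1 = _
    rw [h2]
    have h3 : (⟨(e.symm (S ⟨κ k, Or.inr (hκB k).1⟩)).1, by
        change (S ⟨κ k, Or.inr (hκB k).1⟩).1 ∈ _; rw [h1]; exact hιA⟩ : ↥(A \ B)) =
        eι (π k) := Subtype.ext h1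
    rw [h3]
    simp [j', eκ_apply]
  have hp : ∀ x : ↥(A ∪ B), (F x).1 ∈ A ↔ x.1 ∈ A := by
    intro x
    by_cases hx : x.1 ∈ A
    · simp only [hFA x hx, hx, hτ, hσ]
    · obtain ⟨k, hk⟩ : x.1 ∈ Set.range κ := hκ ▸ ⟨x.2.resolve_left hx, hx⟩
      have : x = ⟨κ k, Or.inr (hκB k).1⟩ := Subtype.ext hk.symm
      rw [this, hFK]
      simp [(hκB _).2]
  have hp' : ∀ x : ↥(A ∪ B), ¬ (F x).1 ∈ A ↔ ¬ x.1 ∈ A := fun x => not_congr (hp x)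
  let F₁ := F.subtypePerm (p := fun x => x.1 ∈ A) hp
  let F₂ := F.subtypePerm (p := fun x => ¬ x.1 ∈ A) hp'
  have hsplit : F = F₁.subtypeCongr F₂ := by
    ext x
    by_cases hx : x.1 ∈ A
    · rw [Perm.subtypeCongr.left_apply (p := fun x : ↥(A ∪ B) => x.1 ∈ A) _ _ hx]; rfl
    · rw [Perm.subtypeCongr.right_apply (p := fun x : ↥(A ∪ B) => x.1 ∈ A) _ _ hx]; rfl
  have h1 : sign F₁ = (-1) ^ (A.ncard / 2) := by
    rw [sign_of_involution]
    · congr 2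
      rw [← Nat.card_coe_set_eq, Nat.card_eq_fintype_card]
      exact Fintype.card_congr ⟨fun x => ⟨x.1.1, x.2⟩, fun x => ⟨⟨x.1, Or.inl x.2⟩, x.2⟩,
        fun _ => rfl, fun _ => rfl⟩
    · rintro ⟨x, hx⟩
      apply Subtype.ext
      apply Subtype.ext
      change (F (F x)).1 = x.1
      rw [hFA _ ((hp x).2 hx), hFA x hx, hinv _ hx]
    · rintro ⟨x, hx⟩ h
      have : (F x).1 = x.1 := congrArg (fun z => z.1.1) h
      rw [hFA x hx] at this
      exact hfix _ hx this
  let c : K ≃ {x : ↥(A ∪ B) // ¬ x.1 ∈ A} :=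
    eκ.trans ⟨fun x => ⟨⟨x.1, Or.inr x.2.1⟩, x.2.2⟩, fun x => ⟨x.1.1, x.1.2.resolve_left x.2, x.2⟩,
        fun _ => rfl, fun _ => rfl⟩
  have hc : ∀ k, F₂ (c k) = c (π k) := fun k => Subtype.ext (hFK k)
  have h2 : sign F₂ = -(-1) ^ Nat.card K := by
    have : Nonempty {x : ↥(A ∪ B) // ¬ x.1 ∈ A} := c.nonempty_congr.1 inferInstance
    rw [sign_of_forall_sameCycle, Nat.card_eq_fintype_card, Fintype.card_congr c]
    intro x y
    obtain ⟨k, rfl⟩ := c.surjective x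
    obtain ⟨l, rfl⟩ := c.surjective y
    refine rel_of_sameCycle (r := fun k l => F₂.SameCycle (c k) (c l))
      (fun _ => SameCycle.refl _ _) ?_ (hπ k l)
    intro k l h
    rw [← hc, sameCycle_apply_right]
    exact h
  have hfin : (-1 : ℤˣ) ^ ((f '' (A ∪ B)).ncard + (g '' (A ∪ B)).ncard) =
      (-1) ^ (A.ncard / 2) * -(-1) ^ Nat.card K := by
    rw [← hF, hsplit, sign_subtypeCongr, h1, h2]
  have hfin' : (-1 : ℤˣ) ^ ((f '' (A ∪ B)).ncard + (g '' (A ∪ B)).ncard + A.ncard / 2 +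
      Nat.card K + 1) = 1 := by
    rw [pow_succ, pow_add, pow_add _ _ (A.ncard / 2), hfin]
    have hsq : ∀ n : ℕ, (-1 : ℤˣ) ^ n * (-1) ^ n = 1 := fun n => by rw [← mul_pow]; simp
    calc _ = ((-1 : ℤˣ) ^ (A.ncard / 2) * (-1) ^ (A.ncard / 2)) *
          ((-1) ^ Nat.card K * (-1) ^ Nat.card K) := by
            simp [mul_comm, mul_left_comm]
      _ = 1 := by simp [hsq]
  by_contra hodd
  rw [Nat.not_even_iff_odd] at hodd
  rw [hodd.neg_one_pow] at hfin'
  exact absurd hfin' (by decide)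

end Region

/-! ### Homology modulo 2 of a genus-zero map -/

section Exactness

open Module

/-- Exactness in the middle of a three-term complex over a field, by counting dimensions. -/
theorem mem_range_of_dotProduct_eq_zero {k X Vt Q : Type*} [Field k] [Fintype X] [Fintype Vt]
    [Fintype Q] (d₀ : (Vt → k) →ₗ[k] (X → k)) (d₁ : (Q → k) →ₗ[k] (X → k))
    (h₀ : finrank k (LinearMap.ker d₀) ≤ 1) (h₁ : finrank k (LinearMap.ker d₁) ≤ 1)
    (hd : ∀ g φ, d₁ φ ⬝ᵥ d₀ g = 0)
    (hcard : Fintype.card X + 2 ≤ Fintype.card Vt + Fintype.card Q) (c : X → k)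
    (hc : ∀ g, c ⬝ᵥ d₀ g = 0) : c ∈ LinearMap.range d₁ := by
  classical
  let D := dotProductEquiv k X
  have hle : (LinearMap.range d₁).map D.toLinearMap ≤ (LinearMap.range d₀).dualAnnihilator := by
    rintro _ ⟨_, ⟨φ, rfl⟩, rfl⟩
    rw [Submodule.mem_dualAnnihilator]
    rintro _ ⟨g, rfl⟩
    simpa [D] using hd g φ
  have e₀ := LinearMap.finrank_range_add_finrank_ker d₀
  have e₁ := LinearMap.finrank_range_add_finrank_ker d₁
  have e₂ := Subspace.finrank_add_finrank_dualAnnihilator_eq (LinearMap.range d₀)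
  have e₃ : finrank k ((LinearMap.range d₁).map D.toLinearMap) = finrank k (LinearMap.range d₁) :=
    LinearEquiv.finrank_map_eq D _
  simp only [finrank_fintype_fun_eq_card] at e₀ e₁ e₂
  -- The annihilator has dimension at most `|X| - |Vt| + 1`, which `hcard` bounds by `|Q| - 1`, and
  -- this is at most the rank of `d₁`.
  have heq := Submodule.eq_of_le_of_finrank_le hle (by omega)
  have hmem : D c ∈ (LinearMap.range d₀).dualAnnihilator := by
    rw [Submodule.mem_dualAnnihilator]
    rintro _ ⟨g, rfl⟩
    simpa [D] using hc g
  rw [← heq] at hmem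
  obtain ⟨x, hx, hxc⟩ := hmem
  have : x = c := D.injective hxc
  rwa [← this]

/-- The kernel consists of constants. This is how connectedness of the map and of its dual enters
the dimension count. -/
theorem finrank_ker_le_one {k U M : Type*} [Field k] [Fintype U] [AddCommGroup M] [Module k M]
    (d : (U → k) →ₗ[k] M) (hd : ∀ g, d g = 0 → ∀ v w, g v = g w) :
    finrank k (LinearMap.ker d) ≤ 1 := by
  have hsub : LinearMap.ker d ≤ Submodule.span k {fun _ => (1 : k)} := by
    intro g hg
    rw [Submodule.mem_span_singleton]
    have := hd g hg
    rcases isEmpty_or_nonempty U with hU | ⟨⟨u⟩⟩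
    · exact ⟨0, Subsingleton.elim _ _⟩
    · exact ⟨g u, by ext v; simp [this v u]⟩
  refine (Submodule.finrank_mono hsub).trans ?_
  simpa using finrank_span_le_card (R := k) {fun _ : U => (1 : k)}

/-- In a bipartite map of genus zero, every set of edges that is a cycle modulo `2` bounds a set of
faces. Here `bl` and `wh` map an edge to its ends, and `fc` to the face on its left, as seen from
its black end; `σ` and `τ` are the rotations around black and around white vertices. -/
theorem exists_coloring_of_cycle {X Vt Q : Type*} [Fintype X] [Fintype Vt] [Fintype Q]
    (σ τ : Perm X) (bl wh : X → Vt) (fc : X → Q) (hbl : ∀ x, bl (σ x) = bl x)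
    (hwh : ∀ x, wh (τ x) = wh x) (hfc : ∀ x, fc (τ (σ x)) = fc x)
    (hconn : ∀ g : Vt → ZMod 2, (∀ x, g (bl x) = g (wh x)) → ∀ v w, g v = g w)
    (hconn' : ∀ g : Q → ZMod 2, (∀ x, g (fc x) = g (fc (τ x))) → ∀ v w, g v = g w)
    (hcard : Fintype.card X + 2 ≤ Fintype.card Vt + Fintype.card Q) (c : X → ZMod 2)
    (hc : ∀ g : Vt → ZMod 2, ∑ x, c x * (g (bl x) + g (wh x)) = 0) :
    ∃ φ : Q → ZMod 2, ∀ x, φ (fc x) + φ (fc (τ x)) = c x := by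
  let d₀ : (Vt → ZMod 2) →ₗ[ZMod 2] (X → ZMod 2) :=
    LinearMap.funLeft (ZMod 2) (ZMod 2) bl + LinearMap.funLeft (ZMod 2) (ZMod 2) wh
  let d₁ : (Q → ZMod 2) →ₗ[ZMod 2] (X → ZMod 2) :=
    LinearMap.funLeft (ZMod 2) (ZMod 2) fc + LinearMap.funLeft (ZMod 2) (ZMod 2) (fc ∘ τ)
  have two : ∀ a b : ZMod 2, a + b = 0 → a = b := by decide
  have hmem : c ∈ LinearMap.range d₁ := by
    refine mem_range_of_dotProduct_eq_zero d₀ d₁ ?_ ?_ ?_ hcard c ?_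
    · exact finrank_ker_le_one d₀ fun g hg => hconn g fun x => two _ _ (congrFun hg x)
    · exact finrank_ker_le_one d₁ fun g hg => hconn' g fun x => two _ _ (congrFun hg x)
    · intro g φ
      -- Every corner at a white vertex lies between two consecutive edges and is counted once for
      -- each, so its contributions cancel modulo 2; `h2` is the same at black vertices.
      have h1 : ∑ x, φ (fc (τ x)) * g (wh x) = ∑ x, φ (fc x) * g (wh x) := by
        rw [← Equiv.sum_comp τ (fun x => φ (fc x) * g (wh x))]
        simp [hwh]
      have h2 : ∑ x, φ (fc (τ x)) * g (bl x) = ∑ x, φ (fc x) * g (bl x) := by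
        rw [← Equiv.sum_comp σ (fun x => φ (fc (τ x)) * g (bl x))]
        simp [hbl, hfc]
      have h3 : d₁ φ ⬝ᵥ d₀ g = (∑ x, φ (fc x) * g (wh x) + ∑ x, φ (fc (τ x)) * g (wh x)) +
          (∑ x, φ (fc x) * g (bl x) + ∑ x, φ (fc (τ x)) * g (bl x)) := by
        simp only [dotProduct, ← Finset.sum_add_distrib]
        refine Finset.sum_congr rfl fun x _ => ?_
        simp [d₀, d₁]
        ring
      rw [h3, h1, h2, CharTwo.add_self_eq_zero, CharTwo.add_self_eq_zero, add_zero]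
    · intro g
      simpa [d₀, dotProduct] using hc g
  obtain ⟨φ, hφ⟩ := hmem
  exact ⟨φ, fun x => congrFun hφ x⟩

end Exactness

/-! ### A simple cycle bounds a region -/

open Classical in
theorem sum_ite_mem_range_mul {X K R : Type*} [Fintype X] [Fintype K] [NonAssocSemiring R]
    {η : K → X} (hη : Function.Injective η) (G : X → R) :
    ∑ x, (if x ∈ Set.range η then 1 else 0) * G x = ∑ k, G (η k) := by
  rw [← Finset.sum_image (s := Finset.univ) (g := η) (f := G) (fun _ _ _ _ h => hη h)]
  rw [← Finset.sum_subset (Finset.subset_univ (Finset.univ.image η))]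
  · refine Finset.sum_congr rfl fun x hx => ?_
    rw [if_pos (by simpa using hx), one_mul]
  · intro x _ hx
    rw [if_neg (by simpa using hx), zero_mul]

/-- In a bipartite quadrangulated map of genus zero, a simple cycle, with edges alternately `ι k` and
`κ k`, bounds a region not containing the outer face `o`; the conclusion includes a parity form of
Euler's formula for this region. -/
theorem exists_region_of_cycle {X Vt Q : Type*} [Fintype X] [Fintype Vt] [Fintype Q]
    (σ τ : Perm X) (bl wh : X → Vt) (fc : X → Q) (hbl : ∀ x, bl (σ x) = bl x)
    (hwh : ∀ x, wh (τ x) = wh x) (hfc : ∀ x, fc (τ (σ x)) = fc x)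
    (hblc : ∀ x y, bl x = bl y → σ.SameCycle x y) (hwhc : ∀ x y, wh x = wh y → τ.SameCycle x y)
    (hconn : ∀ g : Vt → ZMod 2, (∀ x, g (bl x) = g (wh x)) → ∀ v w, g v = g w)
    (hconn' : ∀ g : Q → ZMod 2, (∀ x, g (fc x) = g (fc (τ x))) → ∀ v w, g v = g w)
    (hcard : Fintype.card X + 2 ≤ Fintype.card Vt + Fintype.card Q) (o : Q)
    (hinv : ∀ x, fc x ≠ o → τ (σ (τ (σ x))) = x) (hfix : ∀ x, fc x ≠ o → τ (σ x) ≠ x)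
    {K : Type*} [Fintype K] [Nonempty K] (ι κ : K → X) (π : Perm K)
    (hπ : ∀ k l, π.SameCycle k l) (hKbl : ∀ k, bl (κ k) = bl (ι (π k)))
    (hKwh : ∀ k, wh (κ k) = wh (ι k)) (hιbl : Function.Injective (bl ∘ ι))
    (hιwh : Function.Injective (wh ∘ ι)) (hικ : ∀ k l, ι k ≠ κ l) :
    ∃ A B : Set X, (∀ x, σ x ∈ B ↔ x ∈ A) ∧ (∀ x, τ x ∈ A ↔ x ∈ B) ∧ (∀ x ∈ A, fc x ≠ o) ∧
      (Set.range ι = A \ B ∧ Set.range κ = B \ A ∨ Set.range κ = A \ B ∧ Set.range ι = B \ A) ∧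
      Even ((bl '' (A ∪ B)).ncard + (wh '' (A ∪ B)).ncard + A.ncard / 2 + Nat.card K + 1) := by
  classical
  have hιi : Function.Injective ι := hιbl.of_comp
  have hκbl : Function.Injective (bl ∘ κ) := fun k l h => π.injective
    (hιbl ((hKbl k).symm.trans (h.trans (hKbl l))))
  have hκwh : Function.Injective (wh ∘ κ) := fun k l h => hιwh
    ((hKwh k).symm.trans (h.trans (hKwh l)))
  have hκi : Function.Injective κ := hκbl.of_comp
  let C : Set X := Set.range ι ∪ Set.range κ
  let c : X → ZMod 2 := fun x => (if x ∈ Set.range ι then 1 else 0) +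
    (if x ∈ Set.range κ then 1 else 0)
  have hcC : ∀ x, c x = if x ∈ C then 1 else 0 := by
    intro x
    by_cases h1 : x ∈ Set.range ι
    · have h2 : x ∉ Set.range κ := by
        obtain ⟨k, rfl⟩ := h1
        rintro ⟨l, hl⟩
        exact hικ k l hl.symm
      simp only [c, C, Set.mem_union, h1, h2, if_true, if_false, true_or, add_zero]
    · by_cases h2 : x ∈ Set.range κ
      · simp only [c, C, Set.mem_union, h1, h2, if_true, if_false, or_true, zero_add]
      · simp only [c, C, Set.mem_union, h1, h2, if_false, or_self, add_zero]
  obtain ⟨φ, hφ⟩ := exists_coloring_of_cycle σ τ bl wh fc hbl hwh hfc hconn hconn' hcard c (by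
    intro g
    simp only [c, add_mul, Finset.sum_add_distrib]
    rw [sum_ite_mem_range_mul hιi, sum_ite_mem_range_mul hκi]
    simp only [hKbl, hKwh, Finset.sum_add_distrib]
    rw [Equiv.sum_comp π (fun k => g (bl (ι k)))]
    exact CharTwo.add_self_eq_zero _)
  -- The colouring is determined only up to a constant; adding `φ o` selects the colour class
  -- without the outer face. `fc (τ x)` is the face on the right of `x`.
  let A : Set X := {x | φ (fc x) + φ o = 1}
  let B : Set X := {x | φ (fc (τ x)) + φ o = 1}
  have hσAB : ∀ x, σ x ∈ B ↔ x ∈ A := fun x => by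
    change φ (fc (τ (σ x))) + φ o = 1 ↔ φ (fc x) + φ o = 1
    rw [hfc]
  have hτAB : ∀ x, τ x ∈ A ↔ x ∈ B := fun x => Iff.rfl
  have hAo : ∀ x ∈ A, fc x ≠ o := by
    intro x hx h
    change φ (fc x) + φ o = 1 at hx
    rw [h, CharTwo.add_self_eq_zero] at hx
    exact absurd hx (by decide)
  have hC : ∀ x, x ∈ C ↔ ¬ (x ∈ A ↔ x ∈ B) := by
    intro x
    have h1 := hφ x
    rw [hcC] at h1
    have h2 : ∀ a b o : ZMod 2, a + b = 1 ↔ ¬ (a + o = 1 ↔ b + o = 1) := by decide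
    change _ ↔ ¬ (φ (fc x) + φ o = 1 ↔ φ (fc (τ x)) + φ o = 1)
    rw [← h2, h1]
    simp
  have hCτ : ∀ x, x ∈ C ↔ ¬ (τ x ∈ A ↔ x ∈ A) := fun x => by
    rw [hC, hτAB, iff_comm (a := x ∈ B)]
  have hCσ : ∀ x, x ∈ C ↔ ¬ (σ x ∈ B ↔ x ∈ B) := fun x => by rw [hC, hσAB]
  have hblS : ∀ x y, σ.SameCycle x y → bl x = bl y := fun x y h =>
    rel_of_sameCycle (r := fun x y => bl x = bl y) (fun _ => rfl)
      (fun a b h => h.trans (hbl b).symm) h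
  have hwhS : ∀ x y, τ.SameCycle x y → wh x = wh y := fun x y h =>
    rel_of_sameCycle (r := fun x y => wh x = wh y) (fun _ => rfl)
      (fun a b h => h.trans (hwh b).symm) h
  have hιC : ∀ k, ι k ∈ C := fun k => Or.inl ⟨k, rfl⟩
  have hκC : ∀ k, κ k ∈ C := fun k => Or.inr ⟨k, rfl⟩
  -- The cycle passes a white vertex just once, so the colour changes there exactly at `ι k` and `κ
  -- k`. Together with the analogue at black vertices, this keeps the region on the same side all
  -- along the cycle.
  have altw : ∀ k, κ k ∈ A ↔ ι k ∉ A := by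
    intro k
    apply mem_iff_notMem_of_two_jumps τ A C hCτ (hιC k) (hικ k k) (hwhc _ _ (hKwh k).symm)
    rintro x (⟨l, rfl⟩ | ⟨l, rfl⟩) hx
    · left
      rw [hιwh (hwhS _ _ hx)]
    · right
      have := hwhS _ _ hx
      rw [← hKwh] at this
      rw [hκwh this]
  have altb : ∀ k, ι (π k) ∈ B ↔ κ k ∉ B := by
    intro k
    apply mem_iff_notMem_of_two_jumps σ B C hCσ (hκC k) (hικ _ _).symm (hblc _ _ (hKbl k))
    rintro x (⟨l, rfl⟩ | ⟨l, rfl⟩) hx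
    · right
      have := hblS _ _ hx
      rw [hKbl] at this
      rw [← hιbl this]
    · left
      rw [hκbl (hblS _ _ hx)]
  have step : ∀ k, ι (π k) ∈ A ↔ ι k ∈ A := by
    intro k
    have h1 := (hC _).1 (hιC (π k))
    have h2 := (hC _).1 (hκC k)
    have h3 := altw k
    have h4 := altb k
    tauto
  have hconst : ∀ k l, ι k ∈ A ↔ ι l ∈ A := fun k l =>
    rel_of_sameCycle (r := fun k l => ι k ∈ A ↔ ι l ∈ A) (fun _ => Iff.rfl)
      (fun a b h => h.trans (step b).symm) (hπ k l)
  obtain ⟨k₀⟩ := ‹Nonempty K›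
  have hblinv : ∀ x ∈ A, τ (σ (τ (σ x))) = x := fun x hx => hinv x (hAo x hx)
  have hblfix : ∀ x ∈ A, τ (σ x) ≠ x := fun x hx => hfix x (hAo x hx)
  have split : ∀ ι' κ' : K → X, C = Set.range ι' ∪ Set.range κ' → (∀ k, ι' k ∈ A) →
      (∀ k, κ' k ∉ A) → Set.range ι' = A \ B ∧ Set.range κ' = B \ A := by
    intro ι' κ' hCe hι' hκ'
    have hdiff : ∀ x, x ∈ C ↔ x ∈ A \ B ∨ x ∈ B \ A := by
      intro x
      rw [hC]
      simp only [Set.mem_sdiff]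
      tauto
    have h1 : ∀ x, x ∈ Set.range ι' → x ∈ A := by rintro _ ⟨k, rfl⟩; exact hι' k
    have h2 : ∀ x, x ∈ Set.range κ' → x ∉ A := by rintro _ ⟨k, rfl⟩; exact hκ' k
    rw [hCe] at hdiff
    constructor <;> ext x <;> have h3 := hdiff x <;> have h4 := h1 x <;> have h5 := h2 x <;>
      simp only [Set.mem_union, Set.mem_sdiff] at h3 ⊢ <;> tauto
  by_cases h0 : ι k₀ ∈ A
  · have hιA : ∀ k, ι k ∈ A := fun k => (hconst k k₀).2 h0
    obtain ⟨hr1, hr2⟩ := split ι κ rfl hιA fun k => by rw [altw, not_not]; exact hιA k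
    exact ⟨A, B, hσAB, hτAB, hAo, Or.inl ⟨hr1, hr2⟩,
      even_of_region σ τ A B hσAB hτAB ι κ hιi hκi hr1 hr2 π hπ bl wh hbl hblc hwh hwhc hKbl hKwh
        hκbl hιwh hblinv hblfix⟩
  · have hιA : ∀ k, ι k ∉ A := fun k => fun h => h0 ((hconst k k₀).1 h)
    obtain ⟨hr1, hr2⟩ := split κ ι (Set.union_comm _ _) (fun k => (altw k).2 (hιA k)) hιA
    -- The region is on the right, so the cycle is run backwards: `ι` and `κ` exchange roles and `π`
    -- is inverted.
    refine ⟨A, B, hσAB, hτAB, hAo, Or.inr ⟨hr1, hr2⟩,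
      even_of_region σ τ A B hσAB hτAB κ ι hκi hιi hr1 hr2 π⁻¹
        (fun k l => sameCycle_inv.2 (hπ k l)) bl wh hbl hblc hwh hwhc ?_
        (fun k => (hKwh k).symm) hιbl hκwh hblinv hblfix⟩
    intro k
    rw [hKbl]
    simp

namespace PlaneEmbedding

variable {V : Type*} {G : SimpleGraph V} (P : PlaneEmbedding G)

/-! ### The extended double graph as a combinatorial map: rotations and their orbits -/

section Rotations

theorem next_apply (d : G.Dart) : P.next d = P.rot.symm d.symm := rfl

theorem next_symm_apply (d : G.Dart) : P.next.symm d = (P.rot d).symm := by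
  rw [Equiv.symm_apply_eq, next_apply, SimpleGraph.Dart.symm_symm, Equiv.symm_apply_apply]

variable {P} in
/-- The dart underlying a boundary dart. -/
def BoundaryDart.dart (b : P.BoundaryDart) : G.Dart := b.1

variable {P} in
/-- A dart with the outer face on its left, as a boundary dart. -/
def boundaryDart {d : G.Dart} (h : P.leftFace d = P.outer) : P.BoundaryDart := ⟨d, h⟩

theorem leftFace_dart (b : P.BoundaryDart) : P.leftFace b.dart = P.outer := b.2

@[simp] theorem dart_boundaryDart {d : G.Dart} (h : P.leftFace d = P.outer) :
    (boundaryDart h).dart = d := rfl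

@[simp] theorem boundaryDart_dart (b : P.BoundaryDart) (h : P.leftFace b.dart = P.outer) :
    boundaryDart h = b := rfl

/-- The cyclic order of the boundary darts. -/
def nextPerm : Perm P.BoundaryDart :=
  P.next.subtypePerm (p := fun d => P.leftFace d = P.outer) fun d => by rw [P.leftFace_next]

theorem dart_nextB (b : P.BoundaryDart) : (P.nextB b).dart = P.next b.dart := rfl

@[simp] theorem nextPerm_symm_nextB (b : P.BoundaryDart) : P.nextPerm.symm (P.nextB b) = b :=
  P.nextPerm.symm_apply_apply b

@[simp] theorem nextB_nextPerm_symm (b : P.BoundaryDart) : P.nextB (P.nextPerm.symm b) = b :=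
  P.nextPerm.apply_symm_apply b

theorem dart_nextPerm_symm (b : P.BoundaryDart) :
    (P.nextPerm.symm b).dart = P.next.symm b.dart := by
  rw [Equiv.eq_symm_apply, ← dart_nextB, nextB_nextPerm_symm]

theorem leftDual_of_eq {d : G.Dart} (h : P.leftFace d = P.outer) :
    P.leftDual d = .boundaryDual (boundaryDart h) := dif_pos h

theorem leftDual_of_ne {d : G.Dart} (h : P.leftFace d ≠ P.outer) :
    P.leftDual d = .innerDual ⟨P.leftFace d, h⟩ := dif_neg h

theorem leftFace_rot (d : G.Dart) : P.leftFace (P.rot d).symm = P.leftFace d := by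
  rw [← P.leftFace_next, next_apply, SimpleGraph.Dart.symm_symm, Equiv.symm_apply_apply]

/-- The edges of the extended double graph, sorted by kind. -/
def edgeEquiv :
    P.Edge ≃ (G.Dart ⊕ G.Dart) ⊕ (P.BoundaryDart ⊕ P.BoundaryDart ⊕ P.BoundaryDart) where
  toFun
    | .primalHalf d => .inl (.inl d)
    | .dualHalf d => .inl (.inr d)
    | .backHalf b => .inr (.inl b)
    | .frontHalf b => .inr (.inr (.inl b))
    | .spoke b => .inr (.inr (.inr b))
  invFun
    | .inl (.inl d) => .primalHalf d
    | .inl (.inr d) => .dualHalf d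
    | .inr (.inl b) => .backHalf b
    | .inr (.inr (.inl b)) => .frontHalf b
    | .inr (.inr (.inr b)) => .spoke b
  left_inv := by rintro (_ | _ | _ | _ | _) <;> rfl
  right_inv := by rintro ((_ | _) | (_ | _ | _)) <;> rfl

/-- The vertices of the extended double graph, sorted by kind. -/
def vertEquiv : P.Vert ≃ (V ⊕ {f : FaceOf P.rot // f ≠ P.outer} ⊕ P.BoundaryDart) ⊕
    (G.edgeSet ⊕ P.BoundaryDart) where
  toFun
    | .primal v => .inl (.inl v)
    | .innerDual f => .inl (.inr (.inl f))
    | .boundaryDual b => .inl (.inr (.inr b))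
    | .white e => .inr (.inl e)
    | .boundaryWhite b => .inr (.inr b)
  invFun
    | .inl (.inl v) => .primal v
    | .inl (.inr (.inl f)) => .innerDual f
    | .inl (.inr (.inr b)) => .boundaryDual b
    | .inr (.inl e) => .white e
    | .inr (.inr b) => .boundaryWhite b
  left_inv := by rintro (_ | _ | _ | _ | _) <;> rfl
  right_inv := by rintro ((_ | _ | _) | (_ | _)) <;> rfl

theorem finite_dart [Finite V] : Finite G.Dart :=
  Finite.of_injective _ SimpleGraph.Dart.toProd_injective

theorem finite_boundaryDart [Finite V] : Finite P.BoundaryDart :=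
  have : Finite G.Dart := finite_dart
  Finite.of_injective (fun b : P.BoundaryDart => b.1) Subtype.val_injective

theorem finite_faceOf [Finite V] : Finite (FaceOf P.rot) :=
  have : Finite G.Dart := finite_dart
  Quotient.finite _

theorem finite_edge [Finite V] : Finite P.Edge :=
  have : Finite G.Dart := finite_dart
  have := P.finite_boundaryDart
  Finite.of_equiv _ P.edgeEquiv.symm

theorem finite_vert [Finite V] : Finite P.Vert :=
  have := P.finite_boundaryDart
  have := P.finite_faceOf
  have : Finite G.edgeSet := Subtype.finite
  Finite.of_equiv _ P.vertEquiv.symm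

open Classical in
/-- The next edge counterclockwise around the black end. -/
noncomputable def blackRotFun : P.Edge → P.Edge
  -- A corner of `G` in the outer face contains one spoke, that of the boundary dart preceding `d`.
  -- One more step leads from this spoke to the primal half of `rot d`.
  | .primalHalf d =>
      if h : P.leftFace d = P.outer then .spoke (P.nextPerm.symm (boundaryDart h))
      else .primalHalf (P.rot d)
  | .dualHalf d =>
      if h : P.leftFace d = P.outer then .backHalf (boundaryDart h) else .dualHalf (P.next d)
  | .backHalf b => .frontHalf (P.nextPerm.symm b)
  | .frontHalf b => .dualHalf (P.next b.dart)
  | .spoke b => .primalHalf b.dart.symm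

theorem blackRotFun_surjective : Function.Surjective P.blackRotFun := by
  rintro (d | d | b | b | b)
  · by_cases h : P.leftFace d.symm = P.outer
    · exact ⟨.spoke (boundaryDart h), by simp [blackRotFun]⟩
    · refine ⟨.primalHalf (P.rot.symm d), ?_⟩
      have : P.leftFace (P.rot.symm d) ≠ P.outer := by
        rwa [← leftFace_rot, Equiv.apply_symm_apply]
      simp [blackRotFun, this]
  · have hl : P.leftFace (P.next.symm d) = P.leftFace d := by
      rw [← P.leftFace_next, Equiv.apply_symm_apply]
    by_cases h : P.leftFace d = P.outer
    · exact ⟨.frontHalf (boundaryDart (hl.trans h)), by simp [blackRotFun]⟩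
    · exact ⟨.dualHalf (P.next.symm d), by simp [blackRotFun, hl, h]⟩
  · exact ⟨.dualHalf b.dart, by simp [blackRotFun, leftFace_dart]⟩
  · exact ⟨.backHalf (P.nextB b), by simp [blackRotFun]⟩
  · refine ⟨.primalHalf (P.nextB b).dart, ?_⟩
    simp only [blackRotFun]
    rw [dif_pos (P.leftFace_dart _), boundaryDart_dart, nextPerm_symm_nextB]

/-- The counterclockwise rotation around the black ends. -/
noncomputable def blackRot [Finite V] : Perm P.Edge :=
  Equiv.ofBijective P.blackRotFun <|
    have := P.finite_edge
    Finite.surjective_iff_bijective.1 P.blackRotFun_surjective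

/-- The counterclockwise rotation around the white ends. -/
def whiteRot : Perm P.Edge where
  toFun
    | .primalHalf d => .dualHalf d.symm
    | .dualHalf d => .primalHalf d
    | .backHalf b => .spoke b
    | .spoke b => .frontHalf b
    | .frontHalf b => .backHalf b
  invFun
    | .primalHalf d => .dualHalf d
    | .dualHalf d => .primalHalf d.symm
    | .backHalf b => .frontHalf b
    | .spoke b => .backHalf b
    | .frontHalf b => .spoke b
  left_inv := by rintro (_ | _ | _ | _ | _) <;> simp
  right_inv := by rintro (_ | _ | _ | _ | _) <;> simp

theorem whiteRot_primalHalf (d : G.Dart) : P.whiteRot (.primalHalf d) = .dualHalf d.symm := rfl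
theorem whiteRot_dualHalf (d : G.Dart) : P.whiteRot (.dualHalf d) = .primalHalf d := rfl
theorem whiteRot_backHalf (b : P.BoundaryDart) : P.whiteRot (.backHalf b) = .spoke b := rfl
theorem whiteRot_spoke (b : P.BoundaryDart) : P.whiteRot (.spoke b) = .frontHalf b := rfl
theorem whiteRot_frontHalf (b : P.BoundaryDart) : P.whiteRot (.frontHalf b) = .backHalf b := rfl

variable [Finite V]

theorem blackRot_primalHalf_of_eq {d : G.Dart} (h : P.leftFace d = P.outer) :
    P.blackRot (.primalHalf d) = .spoke (P.nextPerm.symm (boundaryDart h)) := dif_pos h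

theorem blackRot_primalHalf_of_ne {d : G.Dart} (h : P.leftFace d ≠ P.outer) :
    P.blackRot (.primalHalf d) = .primalHalf (P.rot d) := dif_neg h

theorem blackRot_dualHalf_of_eq {d : G.Dart} (h : P.leftFace d = P.outer) :
    P.blackRot (.dualHalf d) = .backHalf (boundaryDart h) := dif_pos h

theorem blackRot_dualHalf_of_ne {d : G.Dart} (h : P.leftFace d ≠ P.outer) :
    P.blackRot (.dualHalf d) = .dualHalf (P.next d) := dif_neg h

theorem blackRot_backHalf (b : P.BoundaryDart) :
    P.blackRot (.backHalf b) = .frontHalf (P.nextPerm.symm b) := rfl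

theorem blackRot_frontHalf (b : P.BoundaryDart) :
    P.blackRot (.frontHalf b) = .dualHalf (P.next b.dart) := rfl

theorem blackRot_spoke (b : P.BoundaryDart) : P.blackRot (.spoke b) = .primalHalf b.dart.symm := rfl

omit [Finite V] in
theorem blackEnd_spoke (b : P.BoundaryDart) : P.blackEnd (.spoke b) = .primal b.dart.snd := rfl

theorem blackEnd_blackRot (x : P.Edge) : P.blackEnd (P.blackRot x) = P.blackEnd x := by
  rcases x with d | d | b | b | b
  · by_cases h : P.leftFace d = P.outer
    · rw [blackRot_primalHalf_of_eq _ h]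
      rw [blackEnd_spoke, dart_nextPerm_symm, dart_boundaryDart, next_symm_apply]
      exact congrArg Vert.primal (P.rot_fst d)
    · rw [blackRot_primalHalf_of_ne _ h]
      exact congrArg Vert.primal (P.rot_fst d)
  · by_cases h : P.leftFace d = P.outer
    · rw [blackRot_dualHalf_of_eq _ h]
      exact (P.leftDual_of_eq h).symm
    · rw [blackRot_dualHalf_of_ne _ h]
      have h' : P.leftFace (P.next d) ≠ P.outer := by rwa [leftFace_next]
      simp only [blackEnd, leftDual_of_ne _ h, leftDual_of_ne _ h', leftFace_next]
  · simp only [blackRot_backHalf, blackEnd, nextB_nextPerm_symm]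
  · rw [blackRot_frontHalf]
    simp only [blackEnd]
    exact P.leftDual_of_eq ((P.leftFace_next b.dart).trans (P.leftFace_dart b))
  · rfl

omit [Finite V] in
theorem whiteEnd_whiteRot (x : P.Edge) : P.whiteEnd (P.whiteRot x) = P.whiteEnd x := by
  rcases x with d | d | b | b | b
  · rw [whiteRot_primalHalf]
    simp [whiteEnd]
  all_goals rfl

/-- Up to inserted spokes and circular edges, the rotation is `rot` at a vertex of `G` and `next`
around an inner face, and these are transitive there by `rot_cyclic` and by the definition of faces.
At a boundary `◇`-black vertex it is a 3-cycle. -/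
theorem sameCycle_of_blackEnd_eq (x y : P.Edge) (h : P.blackEnd x = P.blackEnd y) :
    P.blackRot.SameCycle x y := by
  have := P.finite_edge
  have : Finite G.Dart := finite_dart
  have one : ∀ x : P.Edge, P.blackRot.SameCycle x (P.blackRot x) := fun x =>
    sameCycle_apply_right.2 (SameCycle.refl _ _)
  have rotStep : ∀ d, P.blackRot.SameCycle (.primalHalf d) (.primalHalf (P.rot d)) := by
    intro d
    by_cases h : P.leftFace d = P.outer
    · refine (one _).trans ((one _).trans ?_)
      rw [blackRot_primalHalf_of_eq _ h, blackRot_spoke, dart_nextPerm_symm, dart_boundaryDart,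
        next_symm_apply, SimpleGraph.Dart.symm_symm]
    · rw [← blackRot_primalHalf_of_ne _ h]
      exact one _
  have primal : ∀ d d' : G.Dart, d.fst = d'.fst →
      P.blackRot.SameCycle (.primalHalf d) (.primalHalf d') := fun d d' h =>
    rel_of_sameCycle (r := fun d d' => P.blackRot.SameCycle (.primalHalf d) (.primalHalf d'))
      (fun _ => SameCycle.refl _ _) (fun a b h => h.trans (rotStep b)) (P.rot_cyclic d d' h)
  have inner : ∀ d d' : G.Dart, P.leftFace d ≠ P.outer → P.leftFace d = P.leftFace d' →
      P.blackRot.SameCycle (.dualHalf d) (.dualHalf d') := by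
    intro d d' hd h
    refine (rel_of_sameCycle (σ := P.next) (r := fun d d' => P.leftFace d = P.leftFace d' ∧
      (P.leftFace d ≠ P.outer → P.blackRot.SameCycle (.dualHalf d) (.dualHalf d')))
      (fun _ => ⟨rfl, fun _ => SameCycle.refl _ _⟩) ?_ (Quotient.exact h)).2 hd
    rintro a b ⟨h1, h2⟩
    refine ⟨h1.trans (P.leftFace_next b).symm, fun ha => (h2 ha).trans ?_⟩
    rw [← blackRot_dualHalf_of_ne _ (h1 ▸ ha)]
    exact one _
  /- each edge is in the orbit of a standard edge at its black end -/
  have toPrimal : ∀ x v, P.blackEnd x = .primal v →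
      ∃ d : G.Dart, d.fst = v ∧ P.blackRot.SameCycle x (.primalHalf d) := by
    rintro (d | d | b | b | b) v h
    · exact ⟨d, by simpa [blackEnd] using h, SameCycle.refl _ _⟩
    · by_cases hd : P.leftFace d = P.outer <;> simp [blackEnd, leftDual, hd] at h
    · simp [blackEnd] at h
    · simp [blackEnd] at h
    · exact ⟨b.dart.symm, by simpa [blackEnd_spoke] using h, P.blackRot_spoke b ▸ one _⟩
  have toBoundary : ∀ x b, P.blackEnd x = .boundaryDual b →
      P.blackRot.SameCycle x (.dualHalf b.dart) := by
    rintro (d | d | b' | b' | b') b h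
    · simp [blackEnd] at h
    · by_cases hd : P.leftFace d = P.outer
      · simp only [blackEnd, leftDual_of_eq _ hd, Vert.boundaryDual.injEq] at h
        rw [← h, dart_boundaryDart]
      · simp [blackEnd, leftDual_of_ne _ hd] at h
    · simp only [blackEnd, Vert.boundaryDual.injEq] at h
      subst h
      have := one (.dualHalf b'.dart)
      rw [P.blackRot_dualHalf_of_eq (P.leftFace_dart b'), boundaryDart_dart] at this
      exact this.symm
    · simp only [blackEnd, Vert.boundaryDual.injEq] at h
      subst h
      rw [dart_nextB, ← P.blackRot_frontHalf]
      exact one _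
    · simp [blackEnd] at h
  have toInner : ∀ x f, P.blackEnd x = .innerDual f →
      ∃ d, P.leftFace d = f.1 ∧ x = .dualHalf d := by
    rintro (d | d | b' | b' | b') f h
    · simp [blackEnd] at h
    · by_cases hd : P.leftFace d = P.outer <;> simp [blackEnd, leftDual, hd] at h
      exact ⟨d, by rw [← h], rfl⟩
    all_goals simp [blackEnd] at h
  rcases hx : P.blackEnd x with v | f | b | w | w
  · obtain ⟨d, hd, hxd⟩ := toPrimal x v hx
    obtain ⟨d', hd', hyd⟩ := toPrimal y v (h ▸ hx)
    exact hxd.trans ((primal d d' (hd.trans hd'.symm)).trans hyd.symm)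
  · obtain ⟨d, hd, rfl⟩ := toInner x f hx
    obtain ⟨d', hd', rfl⟩ := toInner y f (h ▸ hx)
    exact inner d d' (hd ▸ f.2) (hd.trans hd'.symm)
  · exact (toBoundary x b hx).trans (toBoundary y b (h ▸ hx)).symm
  all_goals
    rcases x with d | d | b | b | b <;> simp [blackEnd] at hx
    by_cases hd : P.leftFace d = P.outer <;> simp [leftDual, hd] at hx

omit [Finite V] in
theorem sameCycle_of_whiteEnd_eq (x y : P.Edge) (h : P.whiteEnd x = P.whiteEnd y) :
    P.whiteRot.SameCycle x y := by
  have one : ∀ x : P.Edge, P.whiteRot.SameCycle x (P.whiteRot x) := fun x =>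
    sameCycle_apply_right.2 (SameCycle.refl _ _)
  have rev : ∀ d : G.Dart, P.whiteRot.SameCycle (.primalHalf d) (.primalHalf d.symm) := fun d =>
    (one _).trans (one _)
  have toPrimal : ∀ x e, P.whiteEnd x = .white e →
      ∃ d : G.Dart, d.edge = e.1 ∧ P.whiteRot.SameCycle x (.primalHalf d) := by
    rintro (d | d | b | b | b) e h <;> simp only [whiteEnd, Vert.white.injEq, reduceCtorEq] at h
    · exact ⟨d, by rw [← h], SameCycle.refl _ _⟩
    · exact ⟨d, by rw [← h], one _⟩
  have toSpoke : ∀ x b, P.whiteEnd x = .boundaryWhite b → P.whiteRot.SameCycle x (.spoke b) := by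
    rintro (d | d | b' | b' | b') b h <;>
      simp only [whiteEnd, Vert.boundaryWhite.injEq, reduceCtorEq] at h
    · exact h ▸ one _
    · exact h ▸ (one _).trans (one _)
    · rw [h]
  rcases hx : P.whiteEnd x with v | f | b | e | b
  · rcases x with d | d | b | b | b <;> simp [whiteEnd] at hx
  · rcases x with d | d | b | b | b <;> simp [whiteEnd] at hx
  · rcases x with d | d | b | b | b <;> simp [whiteEnd] at hx
  · obtain ⟨d, hd, hxd⟩ := toPrimal x e hx
    obtain ⟨d', hd', hyd⟩ := toPrimal y e (h ▸ hx)
    refine hxd.trans (SameCycle.trans ?_ hyd.symm)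
    rcases SimpleGraph.dart_edge_eq_iff d d' |>.1 (hd.trans hd'.symm) with rfl | rfl
    · exact SameCycle.refl _ _
    · exact (rev _).symm
  · exact (toSpoke x b hx).trans (toSpoke y b (h ▸ hx)).symm

end Rotations

/-! ### The extended double graph as a combinatorial map: faces, connectedness, Euler's formula -/

section Faces

open Classical in
/-- The face on the left of an edge, as seen from its black end; `none` stands for the outer face,
`some (inl d)` for the quadrangle containing the initial half of `d` and the face on the left of `d`,
and `some (inr b)` for the quadrangle at the spoke and the dual half-edge of `b`. -/
noncomputable def faceLeft : P.Edge → Option (G.Dart ⊕ P.BoundaryDart)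
  | .primalHalf d => some (.inl d)
  | .dualHalf d =>
      if h : P.leftFace d = P.outer then some (.inr (boundaryDart h)) else some (.inl (P.next d))
  | .backHalf _ => none
  | .frontHalf b => some (.inl (P.next b.dart))
  | .spoke b => some (.inr b)

variable [Finite V]

omit [Finite V] in
theorem faceLeft_dualHalf_of_ne {d : G.Dart} (h : P.leftFace d ≠ P.outer) :
    P.faceLeft (.dualHalf d) = some (.inl (P.next d)) := dif_neg h

/-- The composite rotation turns around the face on the left. Constancy of the label, with the Euler
count, is all that the homology argument uses; the faces need not be identified with the orbits. -/
theorem faceLeft_whiteRot_blackRot (x : P.Edge) :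
    P.faceLeft (P.whiteRot (P.blackRot x)) = P.faceLeft x := by
  rcases x with d | d | b | b | b
  · by_cases h : P.leftFace d = P.outer
    · rw [blackRot_primalHalf_of_eq _ h, whiteRot_spoke]
      simp [faceLeft, dart_nextPerm_symm]
    · rw [blackRot_primalHalf_of_ne _ h, whiteRot_primalHalf]
      have h' : P.leftFace (P.rot d).symm ≠ P.outer := by rwa [leftFace_rot]
      rw [faceLeft_dualHalf_of_ne _ h', ← next_symm_apply, Equiv.apply_symm_apply, faceLeft]
  · by_cases h : P.leftFace d = P.outer
    · rw [blackRot_dualHalf_of_eq _ h, whiteRot_backHalf]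
      simp [faceLeft, h]
    · rw [blackRot_dualHalf_of_ne _ h, whiteRot_dualHalf]
      simp [faceLeft, h]
  · rfl
  · rfl
  · rw [blackRot_spoke, whiteRot_primalHalf, SimpleGraph.Dart.symm_symm]
    simp [faceLeft, leftFace_dart]

/-- Every face but the outer one is a quadrangle, hence has two edges with the face on their left as
seen from the black end. The excluded edges are the `backHalf`s. -/
theorem whiteRot_blackRot_involutive (x : P.Edge) (hx : P.faceLeft x ≠ none) :
    P.whiteRot (P.blackRot (P.whiteRot (P.blackRot x))) = x := by
  rcases x with d | d | b | b | b
  · by_cases h : P.leftFace d = P.outer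
    · rw [blackRot_primalHalf_of_eq _ h, whiteRot_spoke, blackRot_frontHalf, whiteRot_dualHalf,
        dart_nextPerm_symm, dart_boundaryDart, Equiv.apply_symm_apply]
    · have h' : P.leftFace (P.rot d).symm ≠ P.outer := by rwa [leftFace_rot]
      rw [blackRot_primalHalf_of_ne _ h, whiteRot_primalHalf, blackRot_dualHalf_of_ne _ h',
        whiteRot_dualHalf, ← next_symm_apply, Equiv.apply_symm_apply]
  · by_cases h : P.leftFace d = P.outer
    · rw [blackRot_dualHalf_of_eq _ h, whiteRot_backHalf, blackRot_spoke, whiteRot_primalHalf,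
        SimpleGraph.Dart.symm_symm, dart_boundaryDart]
    · have h' : P.leftFace (P.next d) ≠ P.outer := by rwa [leftFace_next]
      rw [blackRot_dualHalf_of_ne _ h, whiteRot_dualHalf, blackRot_primalHalf_of_ne _ h',
        whiteRot_primalHalf, ← next_symm_apply, Equiv.symm_apply_apply]
  · exact absurd rfl hx
  · have h : P.leftFace (P.next b.dart) = P.outer :=
      (P.leftFace_next b.dart).trans (P.leftFace_dart b)
    rw [blackRot_frontHalf, whiteRot_dualHalf, blackRot_primalHalf_of_eq _ h, whiteRot_spoke]
    exact congrArg Edge.frontHalf (P.nextPerm_symm_nextB b)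
  · rw [blackRot_spoke, whiteRot_primalHalf, SimpleGraph.Dart.symm_symm,
      blackRot_dualHalf_of_eq _ (P.leftFace_dart b), boundaryDart_dart, whiteRot_backHalf]

theorem whiteRot_blackRot_ne (x : P.Edge) (hx : P.faceLeft x ≠ none) :
    P.whiteRot (P.blackRot x) ≠ x := by
  rcases x with d | d | b | b | b
  · by_cases h : P.leftFace d = P.outer
    · rw [blackRot_primalHalf_of_eq _ h, whiteRot_spoke]; simp
    · rw [blackRot_primalHalf_of_ne _ h, whiteRot_primalHalf]; simp
  · by_cases h : P.leftFace d = P.outer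
    · rw [blackRot_dualHalf_of_eq _ h, whiteRot_backHalf]; simp
    · rw [blackRot_dualHalf_of_ne _ h, whiteRot_dualHalf]; simp
  · exact absurd rfl hx
  · rw [blackRot_frontHalf, whiteRot_dualHalf]; simp
  · rw [blackRot_spoke, whiteRot_primalHalf]; simp

omit [Finite V] in
theorem faceLeft_surjective : Function.Surjective P.faceLeft := by
  rintro (_ | d | b)
  · obtain ⟨d, hd⟩ := Quotient.exists_rep P.outer
    exact ⟨.backHalf (boundaryDart hd), rfl⟩
  · exact ⟨.primalHalf d, rfl⟩
  · exact ⟨.spoke b, rfl⟩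

-- Connectedness in terms of edges: every edge is linked to a primal half, and primal halves are
-- linked along walks in `G`. It yields connectedness both of the double graph and of its dual.
omit [Finite V] in
theorem eq_of_blackEnd_of_whiteEnd {γ : Type*} (h : P.Edge → γ)
    (hb : ∀ x y, P.blackEnd x = P.blackEnd y → h x = h y)
    (hw : ∀ x y, P.whiteEnd x = P.whiteEnd y → h x = h y) (x y : P.Edge) : h x = h y := by
  have adj : ∀ d : G.Dart, h (.primalHalf d) = h (.primalHalf d.symm) := fun d =>
    hw _ _ (by simp [whiteEnd])
  have walk : ∀ {v w : V} (p : G.Walk v w) (d d' : G.Dart), d.fst = v → d'.fst = w →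
      h (.primalHalf d) = h (.primalHalf d') := by
    intro v w p
    induction p with
    | nil => exact fun d d' h1 h2 => hb _ _ (by simp [blackEnd, h1, h2])
    | @cons u v w hadj p ih =>
      intro d d' h1 h2
      rw [← ih (SimpleGraph.Dart.mk (u, v) hadj).symm d' rfl h2, ← adj]
      exact hb _ _ (by simp [blackEnd, h1])
  have toPrimal : ∀ x, ∃ d, h x = h (.primalHalf d) := by
    have spoke : ∀ b, h (.spoke b) = h (.primalHalf b.dart.symm) := fun b =>
      hb _ _ rfl
    rintro (d | d | b | b | b)
    · exact ⟨d, rfl⟩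
    · exact ⟨d, hw _ _ rfl⟩
    · exact ⟨_, (hw (.backHalf b) (.spoke b) rfl).trans (spoke b)⟩
    · exact ⟨_, (hw (.frontHalf b) (.spoke b) rfl).trans (spoke b)⟩
    · exact ⟨_, spoke b⟩
  obtain ⟨d, hd⟩ := toPrimal x
  obtain ⟨d', hd'⟩ := toPrimal y
  obtain ⟨p⟩ := P.connected.preconnected d.fst d'.fst
  rw [hd, hd', walk p d d' rfl rfl]

omit [Finite V] in
theorem exists_end_eq (v : P.Vert) : ∃ x, P.blackEnd x = v ∨ P.whiteEnd x = v := by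
  rcases v with v | ⟨f, hf⟩ | b | ⟨e, he⟩ | b
  · obtain ⟨d, hd⟩ : ∃ d : G.Dart, d.fst = v := by
      -- The outer face is an orbit of darts, so `G` has a dart; connectedness then gives one at
      -- every vertex.
      obtain ⟨d, -⟩ := Quotient.exists_rep P.outer
      by_cases h : v = d.fst
      · exact ⟨d, h.symm⟩
      · obtain ⟨p⟩ := P.connected.preconnected v d.fst
        cases p with
        | nil => exact absurd rfl h
        | cons hadj _ => exact ⟨⟨(_, _), hadj⟩, rfl⟩
    exact ⟨.primalHalf d, Or.inl (by simp [blackEnd, hd])⟩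
  · obtain ⟨d, rfl⟩ := Quotient.exists_rep f
    exact ⟨.dualHalf d, Or.inl (P.leftDual_of_ne hf)⟩
  · exact ⟨.backHalf b, Or.inl rfl⟩
  · induction e using Sym2.ind with
    | _ u v => exact ⟨.primalHalf ⟨(u, v), he⟩, Or.inr rfl⟩
  · exact ⟨.backHalf b, Or.inr rfl⟩

omit [Finite V] in
theorem eq_of_blackEnd_eq_whiteEnd {γ : Type*} (g : P.Vert → γ)
    (hg : ∀ x, g (P.blackEnd x) = g (P.whiteEnd x)) (v w : P.Vert) : g v = g w := by
  have key := P.eq_of_blackEnd_of_whiteEnd (fun x => g (P.blackEnd x))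
    (fun x y h => by simp only [h]) (fun x y h => by simp only [hg, h])
  have ends : ∀ v, ∃ x, g v = g (P.blackEnd x) := fun v => by
    obtain ⟨x, rfl | rfl⟩ := P.exists_end_eq v
    · exact ⟨x, rfl⟩
    · exact ⟨x, (hg x).symm⟩
  obtain ⟨x, hx⟩ := ends v
  obtain ⟨y, hy⟩ := ends w
  rw [hx, hy, key x y]

theorem eq_of_faceLeft_eq_faceLeft {γ : Type*} (g : Option (G.Dart ⊕ P.BoundaryDart) → γ)
    (hg : ∀ x, g (P.faceLeft x) = g (P.faceLeft (P.whiteRot x)))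
    (v w : Option (G.Dart ⊕ P.BoundaryDart)) : g v = g w := by
  have := P.finite_edge
  have key := P.eq_of_blackEnd_of_whiteEnd (fun x => g (P.faceLeft x))
    (fun x y h => rel_of_sameCycle (r := fun x y => g (P.faceLeft x) = g (P.faceLeft y))
      (fun _ => rfl) (fun a b h => by
        rw [h, hg (P.blackRot b), faceLeft_whiteRot_blackRot]) (P.sameCycle_of_blackEnd_eq x y h))
    (fun x y h => rel_of_sameCycle (r := fun x y => g (P.faceLeft x) = g (P.faceLeft y))
      (fun _ => rfl) (fun a b h => h.trans (hg b)) (P.sameCycle_of_whiteEnd_eq x y h))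
  obtain ⟨x, rfl⟩ := P.faceLeft_surjective v
  obtain ⟨y, rfl⟩ := P.faceLeft_surjective w
  exact key x y

/-- Euler's formula for the extended double graph. -/
theorem euler_doubleGraph :
    Nat.card P.Edge + 2 = Nat.card P.Vert + Nat.card (Option (G.Dart ⊕ P.BoundaryDart)) := by
  classical
  have : Finite G.Dart := finite_dart
  have := P.finite_boundaryDart
  have := P.finite_faceOf
  have : Finite G.edgeSet := Subtype.finite
  have h1 : Nat.card P.Edge = 2 * Nat.card G.Dart + 3 * Nat.card P.BoundaryDart := by
    rw [Nat.card_congr P.edgeEquiv]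
    simp only [Nat.card_sum]
    ring
  have h2 : Nat.card P.Vert = Nat.card V + Nat.card {f : FaceOf P.rot // f ≠ P.outer} +
      Nat.card G.edgeSet + 2 * Nat.card P.BoundaryDart := by
    rw [Nat.card_congr P.vertEquiv]
    simp only [Nat.card_sum]
    ring
  have h3 : Nat.card (Option (G.Dart ⊕ P.BoundaryDart)) =
      Nat.card G.Dart + Nat.card P.BoundaryDart + 1 := by
    rw [Finite.card_option, Nat.card_sum]
  have h4 : Nat.card (FaceOf P.rot) = Nat.card {f : FaceOf P.rot // f ≠ P.outer} + 1 := by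
    rw [← Finite.card_option]
    exact Nat.card_congr (Equiv.optionSubtypeNe P.outer).symm
  have h5 : Nat.card G.Dart = 2 * Nat.card G.edgeSet := by
    cases nonempty_fintype V
    rw [Nat.card_eq_fintype_card, SimpleGraph.dart_card_eq_twice_card_edges,
      Nat.card_eq_fintype_card, SimpleGraph.edgeFinset_card]
  -- With `n` boundary darts, the extended double graph has `4|E| + 3n` edges, `|V| + (|F| - 1) +
  -- |E| + 2n` vertices and `2|E| + n + 1` faces, so its Euler formula reduces to that of `G`.
  have h6 := P.euler
  omega

end Faces

/-! ### Matchings and local conditions in terms of black and white ends -/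

theorem isBlack_blackEnd (x : P.Edge) : P.IsBlack (P.blackEnd x) := by
  rcases x with d | d | b | b | b
  · trivial
  · by_cases h : P.leftFace d = P.outer
    · simp only [blackEnd, leftDual_of_eq _ h, IsBlack]
    · simp only [blackEnd, leftDual_of_ne _ h, IsBlack]
  all_goals trivial

theorem not_isBlack_whiteEnd (x : P.Edge) : ¬ P.IsBlack (P.whiteEnd x) := by
  rcases x with d | d | b | b | b <;> exact not_false

theorem blackEnd_ne_whiteEnd (x y : P.Edge) : P.blackEnd x ≠ P.whiteEnd y := fun h =>
  P.not_isBlack_whiteEnd y (h ▸ P.isBlack_blackEnd x)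

theorem isLink_iff (e : P.Edge) (v w : P.Vert) : P.doubleGraph.IsLink e v w ↔
    (v = P.blackEnd e ∧ w = P.whiteEnd e) ∨ (v = P.whiteEnd e ∧ w = P.blackEnd e) := Iff.rfl

theorem inc_iff (e : P.Edge) (v : P.Vert) :
    P.doubleGraph.Inc e v ↔ v = P.blackEnd e ∨ v = P.whiteEnd e := by
  simp only [Graph.Inc, isLink_iff]
  constructor
  · rintro ⟨w, ⟨h, -⟩ | ⟨h, -⟩⟩
    · exact Or.inl h
    · exact Or.inr h
  · rintro (h | h)
    · exact ⟨_, Or.inl ⟨h, rfl⟩⟩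
    · exact ⟨_, Or.inr ⟨h, rfl⟩⟩

theorem mem_around_whiteEnd_iff (T : Set P.Edge) (x y : P.Edge) :
    x ∈ P.around T (P.whiteEnd y) ↔ x ∈ T ∧ P.whiteEnd x = P.whiteEnd y := by
  have := P.blackEnd_ne_whiteEnd x y
  simp only [around, Set.mem_ofPred_eq, inc_iff, eq_comm (a := P.whiteEnd y), this, false_or]

/-- A perfect matching of the double graph without the black vertex `s`, in terms of the black and
white ends of edges. -/
structure IsDimerAwayFrom (s : P.Vert) (M : Set P.Edge) : Prop where
  blackEnd_ne : ∀ e ∈ M, P.blackEnd e ≠ s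
  exists_blackEnd_eq : ∀ v, P.IsBlack v → v ≠ s → ∃ e ∈ M, P.blackEnd e = v
  exists_whiteEnd_eq : ∀ x, ∃ e ∈ M, P.whiteEnd e = P.whiteEnd x
  blackEnd_inj : ∀ e ∈ M, ∀ e' ∈ M, P.blackEnd e = P.blackEnd e' → e = e'
  whiteEnd_inj : ∀ e ∈ M, ∀ e' ∈ M, P.whiteEnd e = P.whiteEnd e' → e = e'

theorem isDimerAwayFrom_of_isPerfectMatching {s : P.Vert} (hs : P.IsBlack s) {M : Set P.Edge}
    (hM : IsPerfectMatching (P.doubleGraphMinus s) M) : P.IsDimerAwayFrom s M := by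
  have hinc : ∀ e v, (P.doubleGraphMinus s).Inc e v ↔
      P.doubleGraph.Inc e v ∧ v ≠ s ∧ P.blackEnd e ≠ s := by
    intro e v
    have hw : P.whiteEnd e ≠ s := fun h => P.not_isBlack_whiteEnd e (h ▸ hs)
    simp only [Graph.Inc, doubleGraphMinus, Graph.deleteVerts_isLink, Set.mem_singleton_iff,
      isLink_iff]
    constructor
    · rintro ⟨w, ⟨rfl, rfl⟩ | ⟨rfl, rfl⟩, h1, h2⟩
      · exact ⟨⟨_, Or.inl ⟨rfl, rfl⟩⟩, h1, h1⟩
      · exact ⟨⟨_, Or.inr ⟨rfl, rfl⟩⟩, h1, h2⟩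
    · rintro ⟨⟨w, ⟨rfl, rfl⟩ | ⟨rfl, rfl⟩⟩, h1, h2⟩
      · exact ⟨_, Or.inl ⟨rfl, rfl⟩, h1, hw⟩
      · exact ⟨_, Or.inr ⟨rfl, rfl⟩, h1, h2⟩
  have hne : ∀ e ∈ M, P.blackEnd e ≠ s := by
    intro e he
    obtain ⟨x, y, hxy⟩ := Graph.exists_isLink_of_mem_edgeSet (hM.1 he)
    exact ((hinc e x).1 ⟨y, hxy⟩).2.2
  have huniq : ∀ v, v ≠ s → ∃! e, e ∈ M ∧ P.doubleGraph.Inc e v := by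
    intro v hv
    obtain ⟨e, ⟨he, hev⟩, hu⟩ := hM.2 v (by
      rw [doubleGraphMinus, Graph.vertexSet_deleteVerts]
      exact ⟨Set.mem_univ _, hv⟩)
    exact ⟨e, ⟨he, ((hinc e v).1 hev).1⟩, fun e' he' =>
      hu e' ⟨he'.1, (hinc e' v).2 ⟨he'.2, hv, hne e' he'.1⟩⟩⟩
  refine ⟨hne, ?_, ?_, ?_, ?_⟩
  · intro v hb hv
    obtain ⟨e, ⟨he, hev⟩, -⟩ := huniq v hv
    rcases (P.inc_iff e v).1 hev with h | h
    · exact ⟨e, he, h.symm⟩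
    · exact absurd (h ▸ hb) (P.not_isBlack_whiteEnd e)
  · intro x
    obtain ⟨e, ⟨he, hev⟩, -⟩ := huniq (P.whiteEnd x) fun h => P.not_isBlack_whiteEnd x (h ▸ hs)
    rcases (P.inc_iff e _).1 hev with h | h
    · exact absurd h.symm (P.blackEnd_ne_whiteEnd _ _)
    · exact ⟨e, he, h.symm⟩
  · intro e he e' he' h
    exact (huniq _ (hne e he)).unique ⟨he, (P.inc_iff _ _).2 (Or.inl rfl)⟩
      ⟨he', (P.inc_iff _ _).2 (Or.inl h)⟩
  · intro e he e' he' h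
    exact (huniq (P.whiteEnd e) fun h => P.not_isBlack_whiteEnd e (h ▸ hs)).unique
      ⟨he, (P.inc_iff _ _).2 (Or.inr rfl)⟩ ⟨he', (P.inc_iff _ _).2 (Or.inr h)⟩

/-- Around each white vertex, a configuration satisfying the local conditions has two edges. -/
theorem exists_around_eq_pair {T : Set P.Edge} (hT : P.SatisfiesLocal T) (x : P.Edge) :
    ∃ p q, p ≠ q ∧ P.around T (P.whiteEnd x) = {p, q} := by
  have inner : ∀ d : G.Dart, ∃ p q, p ≠ q ∧
      P.around T (.white ⟨d.edge, d.edge_mem⟩) = {p, q} := by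
    intro d
    have hd := d.symm_ne.symm
    rcases hT.1 d with h | h | h | h
    · exact ⟨_, _, by simpa using hd, h⟩
    · exact ⟨_, _, by simpa using hd, h⟩
    · exact ⟨_, _, by simp, h⟩
    · exact ⟨_, _, by simp, h⟩
  have bdry : ∀ b, ∃ p q, p ≠ q ∧ P.around T (.boundaryWhite b) = {p, q} := by
    intro b
    rcases hT.2 b with h | h
    · exact ⟨_, _, by simp, h⟩
    · exact ⟨_, _, by simp, h⟩
  rcases x with d | d | b | b | b
  · exact inner d
  · exact inner d
  all_goals exact bdry b

theorem exists_other {T : Set P.Edge} (hT : P.SatisfiesLocal T) {e : P.Edge} (he : e ∈ T) :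
    ∃ f ∈ T, f ≠ e ∧ P.whiteEnd f = P.whiteEnd e ∧
      ∀ x ∈ T, P.whiteEnd x = P.whiteEnd e → x = e ∨ x = f := by
  obtain ⟨p, q, hpq, h⟩ := P.exists_around_eq_pair hT e
  have hmem : ∀ x, (x ∈ T ∧ P.whiteEnd x = P.whiteEnd e) ↔ x = p ∨ x = q := fun x => by
    rw [← mem_around_whiteEnd_iff, h]; rfl
  have hp := (hmem p).2 (Or.inl rfl)
  have hq := (hmem q).2 (Or.inr rfl)
  rcases (hmem e).1 ⟨he, rfl⟩ with h1 | h1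
  · exact ⟨q, hq.1, h1 ▸ hpq.symm, hq.2, fun x hx hxe => h1 ▸ (hmem x).1 ⟨hx, hxe⟩⟩
  · exact ⟨p, hp.1, h1 ▸ hpq, hp.2, fun x hx hxe => h1 ▸ ((hmem x).1 ⟨hx, hxe⟩).symm⟩

/-! ### Counting vertices and corners of a region of the extended double graph -/

section Region

variable [Finite V]

omit [Finite V] in
/-- If the boundary of a region does not meet a vertex of the region, then all faces at this vertex
belong to the region. -/
theorem mem_of_forall_mem_iff {X Y : Type*} [Finite X] (σ : Perm X) (f : X → Y)
    (hf : ∀ x, f (σ x) = f x) (hfc : ∀ x y, f x = f y → σ.SameCycle x y) {A B : Set X}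
    (h : ∀ x, σ x ∈ B ↔ x ∈ A) {x y : X} (hx : x ∈ A ∪ B) (hxy : f x = f y)
    (hAB : ∀ z, f z = f x → (z ∈ A ↔ z ∈ B)) : y ∈ A := by
  have hxA : x ∈ A := hx.elim id (hAB x rfl).2
  refine (rel_of_sameCycle (r := fun x y => f y = f x ∧ ((∀ z, f z = f x → (z ∈ A ↔ z ∈ B)) →
    x ∈ A → y ∈ A)) (fun _ => ⟨rfl, fun _ => id⟩) ?_ (hfc x y hxy)).2 hAB hxA
  rintro a b ⟨h1, h2⟩
  refine ⟨(hf b).trans h1, fun h3 ha => ?_⟩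
  rw [h3 _ ((hf b).trans h1), h]
  exact h2 h3 ha

/-- `M` restricts to a perfect matching of the closed region: its edges at boundary vertices are in
the region by hypothesis, and all edges at an interior vertex are. -/
theorem ncard_blackEnd_image_eq_ncard_whiteEnd_image {s : P.BoundaryDart} {M : Set P.Edge}
    (hM : P.IsDimerAwayFrom (.boundaryDual s) M) {A B : Set P.Edge}
    (hσ : ∀ x, P.blackRot x ∈ B ↔ x ∈ A) (hτ : ∀ x, P.whiteRot x ∈ A ↔ x ∈ B)
    (hA : ∀ x ∈ A, P.faceLeft x ≠ none)
    (hbl : ∀ x, ¬ (x ∈ A ↔ x ∈ B) → ∃ m ∈ M, m ∈ A ∪ B ∧ P.blackEnd m = P.blackEnd x)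
    (hwh : ∀ x, ¬ (x ∈ A ↔ x ∈ B) → ∃ m ∈ M, m ∈ A ∪ B ∧ P.whiteEnd m = P.whiteEnd x) :
    (P.blackEnd '' (A ∪ B)).ncard = (P.whiteEnd '' (A ∪ B)).ncard := by
  have := P.finite_edge
  have h1 : P.blackEnd '' (A ∪ B) = P.blackEnd '' (M ∩ (A ∪ B)) := by
    refine Set.Subset.antisymm ?_ (Set.image_mono Set.inter_subset_right)
    rintro _ ⟨x, hx, rfl⟩
    by_cases h : ∃ y, P.blackEnd y = P.blackEnd x ∧ ¬ (y ∈ A ↔ y ∈ B)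
    · obtain ⟨y, hyx, hy⟩ := h
      obtain ⟨m, hm, hm', hmy⟩ := hbl y hy
      exact ⟨m, ⟨hm, hm'⟩, hmy.trans hyx⟩
    · push Not at h
      have key : ∀ y, P.blackEnd x = P.blackEnd y → y ∈ A := fun y hxy =>
        mem_of_forall_mem_iff P.blackRot P.blackEnd P.blackEnd_blackRot
          P.sameCycle_of_blackEnd_eq hσ hx hxy h
      -- The unmatched vertex `s` is not interior, since `backHalf s` has the outer face on its
      -- left.
      obtain ⟨m, hm, hmx⟩ := hM.exists_blackEnd_eq (P.blackEnd x) (P.isBlack_blackEnd x)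
        fun hs => hA _ (key (.backHalf s) hs) rfl
      exact ⟨m, ⟨hm, Or.inl (key m hmx.symm)⟩, hmx⟩
  have h2 : P.whiteEnd '' (A ∪ B) = P.whiteEnd '' (M ∩ (A ∪ B)) := by
    refine Set.Subset.antisymm ?_ (Set.image_mono Set.inter_subset_right)
    rintro _ ⟨x, hx, rfl⟩
    by_cases h : ∃ y, P.whiteEnd y = P.whiteEnd x ∧ ¬ (y ∈ A ↔ y ∈ B)
    · obtain ⟨y, hyx, hy⟩ := h
      obtain ⟨m, hm, hm', hmy⟩ := hwh y hy
      exact ⟨m, ⟨hm, hm'⟩, hmy.trans hyx⟩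
    · push Not at h
      obtain ⟨m, hm, hmx⟩ := hM.exists_whiteEnd_eq x
      refine ⟨m, ⟨hm, Or.inr ?_⟩, hmx⟩
      exact mem_of_forall_mem_iff P.whiteRot P.whiteEnd P.whiteEnd_whiteRot
          P.sameCycle_of_whiteEnd_eq hτ hx.symm hmx.symm fun z hz => (h z hz).symm
  rw [h1, h2, Set.InjOn.ncard_image fun a ha b hb h => hM.blackEnd_inj a ha.1 b hb.1 h,
    Set.InjOn.ncard_image fun a ha b hb h => hM.whiteEnd_inj a ha.1 b hb.1 h]

/-- The type of a black vertex, as a number: `1` for `•`-black and `0` for `◇`-black vertices. -/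
def kind : P.Vert → ZMod 4
  | .primal _ => 1
  | _ => 0

omit [Finite V] in
theorem kind_leftDual (d : G.Dart) : P.kind (P.leftDual d) = 0 := by
  by_cases h : P.leftFace d = P.outer
  · rw [leftDual_of_eq _ h]; rfl
  · rw [leftDual_of_ne _ h]; rfl

open Classical in
/-- The contribution of an edge to the count of the sectors of a region at white vertices, corrected
by the turns of the boundary of the region. -/
noncomputable def sectorWeight (A B : Set P.Edge) (x : P.Edge) : ZMod 4 :=
  (if x ∈ A then 1 else 0) + (if x ∈ A ∧ x ∉ B then 1 else 0) * (P.kind (P.blackEnd x) - 2) -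
    (if x ∈ B ∧ x ∉ A then 1 else 0) * P.kind (P.blackEnd x)

variable {A B T : Set P.Edge}

-- Off the boundary a white vertex has 0 or 4 corners in the region, which vanish modulo 4. On it,
-- going straight leaves 2 corners, a right turn from dual to primal 3 and a left turn from primal
-- to dual 1, each balanced by the kinds of the two boundary edges.
omit [Finite V] in
theorem sectorWeight_inner (hτ : ∀ x, P.whiteRot x ∈ A ↔ x ∈ B) (hT : P.SatisfiesLocal T)
    (hC : ∀ x, (∀ y, P.whiteEnd y = P.whiteEnd x → (y ∈ A ↔ y ∈ B)) ∨
      ∀ y, P.whiteEnd y = P.whiteEnd x → (y ∈ T ↔ ¬ (y ∈ A ↔ y ∈ B))) (d : G.Dart) :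
    P.sectorWeight A B (.primalHalf d) + P.sectorWeight A B (.dualHalf d) +
      (P.sectorWeight A B (.primalHalf d.symm) + P.sectorWeight A B (.dualHalf d.symm)) = 0 := by
  have b1 := hτ (.primalHalf d)
  have b2 := hτ (.dualHalf d)
  have b3 := hτ (.primalHalf d.symm)
  have b4 := hτ (.dualHalf d.symm)
  simp only [whiteRot_primalHalf, whiteRot_dualHalf, SimpleGraph.Dart.symm_symm] at b1 b2 b3 b4
  have hd := d.symm_ne
  have hd' := d.symm_ne.symm
  have w1 : P.whiteEnd (.primalHalf d.symm) = P.whiteEnd (.primalHalf d) := by simp [whiteEnd]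
  have w2 : P.whiteEnd (.dualHalf d.symm) = P.whiteEnd (.primalHalf d) := by simp [whiteEnd]
  have w3 : P.whiteEnd (.dualHalf d) = P.whiteEnd (.primalHalf d) := rfl
  have hmem : ∀ p q, P.around T (P.whiteEnd (.primalHalf d)) = {p, q} →
      ∀ x, P.whiteEnd x = P.whiteEnd (.primalHalf d) → (x ∈ T ↔ x = p ∨ x = q) := by
    intro p q h x hx
    have := P.mem_around_whiteEnd_iff T x (.primalHalf d)
    rw [h] at this
    simp only [hx, and_true] at this
    exact this.symm
  -- Three of the four half-edges suffice: an even number of them separates the region from its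
  -- complement, so the fourth is determined.
  have cases : ((Edge.primalHalf d ∈ A ↔ Edge.dualHalf d.symm ∈ A) ∧
      (Edge.dualHalf d ∈ A ↔ Edge.primalHalf d ∈ A) ∧
      (Edge.primalHalf d.symm ∈ A ↔ Edge.dualHalf d ∈ A)) ∨
      ∃ p q : P.Edge, ((p, q) = (.primalHalf d, .primalHalf d.symm) ∨
        (p, q) = (.dualHalf d, .dualHalf d.symm) ∨ (p, q) = (.dualHalf d, .primalHalf d) ∨
        (p, q) = (.dualHalf d.symm, .primalHalf d.symm)) ∧
      (¬ (Edge.primalHalf d ∈ A ↔ Edge.dualHalf d.symm ∈ A) ↔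
        (Edge.primalHalf d = p ∨ Edge.primalHalf d = q)) ∧
      (¬ (Edge.dualHalf d ∈ A ↔ Edge.primalHalf d ∈ A) ↔
        (Edge.dualHalf d = p ∨ Edge.dualHalf d = q)) ∧
      (¬ (Edge.primalHalf d.symm ∈ A ↔ Edge.dualHalf d ∈ A) ↔
        (Edge.primalHalf d.symm = p ∨ Edge.primalHalf d.symm = q)) := by
    rcases hC (.primalHalf d) with h | h
    · left
      have c1 := h _ rfl
      have c2 := h _ w3
      have c3 := h _ w1
      rw [← b1] at c1
      rw [← b2] at c2
      rw [← b3] at c3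
      exact ⟨c1, c2, c3⟩
    · right
      have hfin : ∀ p q, P.around T (P.whiteEnd (.primalHalf d)) = {p, q} →
          _ ∧ _ ∧ _ := fun p q hpq =>
        ⟨(by rw [b1, ← h _ rfl]; exact hmem p q hpq _ rfl :
          ¬ (Edge.primalHalf d ∈ A ↔ Edge.dualHalf d.symm ∈ A) ↔
            (Edge.primalHalf d = p ∨ Edge.primalHalf d = q)),
        (by rw [b2, ← h _ w3]; exact hmem p q hpq _ w3 :
          ¬ (Edge.dualHalf d ∈ A ↔ Edge.primalHalf d ∈ A) ↔
            (Edge.dualHalf d = p ∨ Edge.dualHalf d = q)),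
        (by rw [b3, ← h _ w1]; exact hmem p q hpq _ w1 :
          ¬ (Edge.primalHalf d.symm ∈ A ↔ Edge.dualHalf d ∈ A) ↔
            (Edge.primalHalf d.symm = p ∨ Edge.primalHalf d.symm = q))⟩
      rcases hT.1 d with h' | h' | h' | h'
      · exact ⟨_, _, Or.inl rfl, hfin _ _ h'⟩
      · exact ⟨_, _, Or.inr (Or.inl rfl), hfin _ _ h'⟩
      · exact ⟨_, _, Or.inr (Or.inr (Or.inl rfl)), hfin _ _ h'⟩
      · exact ⟨_, _, Or.inr (Or.inr (Or.inr rfl)), hfin _ _ h'⟩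
  have k1 : ∀ d, P.kind (P.blackEnd (.primalHalf d)) = 1 := fun _ => rfl
  have k2 : ∀ d, P.kind (P.blackEnd (.dualHalf d)) = 0 := P.kind_leftDual
  simp only [sectorWeight, k1, k2]
  clear k1 k2 hmem hC hT hτ
  rcases cases with ⟨c1, c2, c3⟩ | ⟨p, q, hpq, c1, c2, c3⟩
  · by_cases h4 : Edge.dualHalf d.symm ∈ A
    · have h1 := c1.2 h4
      have h2 := c2.2 h1
      have h3 := c3.2 h2
      simp only [h1, h2, h3, h4, true_iff] at b1 b2 b3 b4
      simp [h1, h2, h3, h4, b1, b2, b3, b4]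
      decide
    · have h1 := mt c1.1 h4
      have h2 := mt c2.1 h1
      have h3 := mt c3.1 h2
      simp only [h1, h2, h3, h4, false_iff] at b1 b2 b3 b4
      simp [h1, h2, h3, h4, b1, b2, b3, b4]
  · rcases hpq with h | h | h | h <;> obtain ⟨rfl, rfl⟩ := Prod.mk.inj h <;>
      simp [hd, hd'] at c1 c2 c3 <;>
      by_cases h1 : Edge.primalHalf d ∈ A <;> by_cases h2 : Edge.dualHalf d ∈ A <;>
      by_cases h3 : Edge.primalHalf d.symm ∈ A <;> by_cases h4 : Edge.dualHalf d.symm ∈ A <;>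
      simp [h1, h2, h3, h4] at c1 c2 c3 <;>
      simp only [h1, h2, h3, h4, true_iff, false_iff] at b1 b2 b3 b4 <;>
      simp [h1, h2, h3, h4, b1, b2, b3, b4] <;> decide

-- The corner of the outer face is never in the region, so a boundary white vertex off the cycle has
-- no corner. Between `frontHalf` and `backHalf` the region has 2 corners, between `spoke` and
-- `backHalf` it has 1, in accordance with the kinds; a cycle through `spoke` and `frontHalf` would
-- violate the balance.
omit [Finite V] in
theorem sectorWeight_boundary (hτ : ∀ x, P.whiteRot x ∈ A ↔ x ∈ B) (hT : P.SatisfiesLocal T)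
    (hA : ∀ x ∈ A, P.faceLeft x ≠ none)
    (hC : ∀ x, (∀ y, P.whiteEnd y = P.whiteEnd x → (y ∈ A ↔ y ∈ B)) ∨
      ∀ y, P.whiteEnd y = P.whiteEnd x → (y ∈ T ↔ ¬ (y ∈ A ↔ y ∈ B))) (b : P.BoundaryDart) :
    P.sectorWeight A B (.backHalf b) + (P.sectorWeight A B (.frontHalf b) +
      P.sectorWeight A B (.spoke b)) = 0 := by
  have b1 := hτ (.backHalf b)
  have b2 := hτ (.spoke b)
  have b3 := hτ (.frontHalf b)
  simp only [whiteRot_backHalf, whiteRot_spoke, whiteRot_frontHalf] at b1 b2 b3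
  have a1 : Edge.backHalf b ∉ A := fun h => hA _ h rfl
  have k1 : P.kind (P.blackEnd (.backHalf b)) = 0 := rfl
  have k2 : P.kind (P.blackEnd (.frontHalf b)) = 0 := rfl
  have k3 : P.kind (P.blackEnd (.spoke b)) = 1 := rfl
  have hmem : ∀ x, P.whiteEnd x = P.whiteEnd (.spoke b) →
      (x ∈ T ↔ x ∈ P.around T (P.whiteEnd (.spoke b))) := by
    intro x hx
    rw [mem_around_whiteEnd_iff]
    simp [hx]
  have c1 := hmem (.backHalf b) rfl
  have c2 := hmem (.spoke b) rfl
  have c3 := hmem (.frontHalf b) rfl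
  simp only [sectorWeight, k1, k2, k3]
  rcases hC (.spoke b) with h | h
  · have d1 := h (.backHalf b) rfl
    have d2 := h (.spoke b) rfl
    rw [← b1] at d1
    rw [← b2] at d2
    have h1 : Edge.spoke b ∉ A := fun h => a1 (d1.2 h)
    have h2 : Edge.frontHalf b ∉ A := fun h => h1 (d2.2 h)
    simp only [a1, h1, h2, false_iff] at b1 b2 b3
    simp [a1, h1, h2, b1, b2, b3]
  · have d1 := h (.backHalf b) rfl
    have d2 := h (.spoke b) rfl
    have d3 := h (.frontHalf b) rfl
    rw [← b1, c1] at d1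
    rw [← b2, c2] at d2
    rw [← b3, c3] at d3
    have hloc : P.around T (P.whiteEnd (.spoke b)) = {.backHalf b, .frontHalf b} ∨
      P.around T (P.whiteEnd (.spoke b)) = {.backHalf b, .spoke b} := hT.2 b
    rcases hloc with h' | h' <;> rw [h'] at d1 d2 d3 <;> simp [a1] at d1 d2 d3
    · have h2 : Edge.frontHalf b ∈ A := d3
      simp only [a1, d1, h2, false_iff, true_iff] at b1 b2 b3
      simp [a1, d1, h2, b1, b2, b3]
      decide
    · have h2 : Edge.frontHalf b ∉ A := d3
      simp only [a1, d1, h2, false_iff, true_iff] at b1 b2 b3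
      simp [a1, d1, h2, b1, b2]
      decide

theorem sum_sectorWeight [Fintype P.Edge] (hτ : ∀ x, P.whiteRot x ∈ A ↔ x ∈ B)
    (hT : P.SatisfiesLocal T) (hA : ∀ x ∈ A, P.faceLeft x ≠ none)
    (hC : ∀ x, (∀ y, P.whiteEnd y = P.whiteEnd x → (y ∈ A ↔ y ∈ B)) ∨
      ∀ y, P.whiteEnd y = P.whiteEnd x → (y ∈ T ↔ ¬ (y ∈ A ↔ y ∈ B))) :
    ∑ x, P.sectorWeight A B x = 0 := by
  have : Finite G.Dart := finite_dart
  have := P.finite_boundaryDart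
  cases nonempty_fintype G.Dart
  cases nonempty_fintype P.BoundaryDart
  rw [← Equiv.sum_comp P.edgeEquiv.symm]
  simp only [Fintype.sum_sum_type, ← Finset.sum_add_distrib]
  have h1 : ∑ d : G.Dart, (P.sectorWeight A B (.primalHalf d) +
      P.sectorWeight A B (.dualHalf d)) = 0 :=
    -- Each inner white vertex carries the half-edges of two opposite darts, whose contributions
    -- cancel.
    Finset.sum_involution (fun d _ => d.symm)
      (fun d _ => P.sectorWeight_inner hτ hT hC d) (fun d _ _ => d.symm_ne)
      (fun _ _ => Finset.mem_univ _) (fun d _ => d.symm_symm)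
  have h2 : ∑ b : P.BoundaryDart, (P.sectorWeight A B (.backHalf b) +
      (P.sectorWeight A B (.frontHalf b) + P.sectorWeight A B (.spoke b))) = 0 :=
    Finset.sum_eq_zero fun b _ => P.sectorWeight_boundary hτ hT hA hC b
  exact (congrArg₂ (· + ·) h1 h2).trans (add_zero 0)

end Region

/-! ### Alternating paths do not close up -/

/-- Consecutive edges of `M` on a path that alternates between `M` and `T \ M`, starting from
black ends. -/
def Follows (M T : Set P.Edge) (e e' : P.Edge) : Prop :=
  e ∈ M ∧ e' ∈ M ∧ ∃ f ∈ T \ M, P.whiteEnd f = P.whiteEnd e ∧ P.blackEnd f = P.blackEnd e'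

variable {P} {s : P.BoundaryDart} {M T : Set P.Edge}

/-- `T` has just two edges at a white vertex, one of which is in `M`. Hence the way out of a white
vertex is forced, and alternating paths are deterministic. -/
theorem eq_of_whiteEnd_eq_of_notMem (hM : P.IsDimerAwayFrom (.boundaryDual s) M) (hMT : M ⊆ T)
    (hT : P.SatisfiesLocal T) {f f' : P.Edge} (hf : f ∈ T \ M) (hf' : f' ∈ T \ M)
    (h : P.whiteEnd f = P.whiteEnd f') : f = f' := by
  obtain ⟨e, he, hef⟩ := hM.exists_whiteEnd_eq f
  obtain ⟨g, -, -, -, hg⟩ := P.exists_other hT (hMT he)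
  have h1 := (hg f hf.1 hef.symm).resolve_left fun h' => hf.2 (h' ▸ he)
  have h2 := (hg f' hf'.1 (h.symm.trans hef.symm)).resolve_left fun h' => hf'.2 (h' ▸ he)
  rw [h1, h2]

theorem exists_mem_diff_whiteEnd_eq (hM : P.IsDimerAwayFrom (.boundaryDual s) M) (hMT : M ⊆ T)
    (hT : P.SatisfiesLocal T) (x : P.Edge) : ∃ f ∈ T \ M, P.whiteEnd f = P.whiteEnd x := by
  obtain ⟨e, he, hex⟩ := hM.exists_whiteEnd_eq x
  obtain ⟨g, hgT, hge, hgw, -⟩ := P.exists_other hT (hMT he)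
  exact ⟨g, ⟨hgT, fun hgM => hge (hM.whiteEnd_inj g hgM e he hgw)⟩, hgw.trans hex⟩

theorem follows_rightUnique (hM : P.IsDimerAwayFrom (.boundaryDual s) M) (hMT : M ⊆ T)
    (hT : P.SatisfiesLocal T) : Relator.RightUnique (P.Follows M T) := by
  rintro e a b ⟨-, ha, f, hf, hfe, hfa⟩ ⟨-, hb, g, hg, hge, hgb⟩
  have hfg := eq_of_whiteEnd_eq_of_notMem hM hMT hT hf hg (hfe.trans hge.symm)
  exact hM.blackEnd_inj a ha b hb (hfa.symm.trans (hfg ▸ hgb))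

/-- There is no closed path alternating between a perfect matching and the other edges of a
configuration satisfying the local conditions. -/
theorem not_transGen_follows [Finite V] (hM : P.IsDimerAwayFrom (.boundaryDual s) M) (hMT : M ⊆ T)
    (hT : P.SatisfiesLocal T) (e : P.Edge) : ¬ Relation.TransGen (P.Follows M T) e e := by
  classical
  intro hcycle
  have := P.finite_edge
  have := P.finite_vert
  have : Finite G.Dart := finite_dart
  have := P.finite_boundaryDart
  cases nonempty_fintype P.Edge
  cases nonempty_fintype P.Vert
  cases nonempty_fintype G.Dart
  cases nonempty_fintype P.BoundaryDart
  obtain ⟨K, π, heK, hstep, hπ⟩ := exists_cycle_of_transGen (follows_rightUnique hM hMT hT) hcycle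
  cases nonempty_fintype K
  have : Nonempty K := ⟨⟨e, heK⟩⟩
  -- `K` is the set of edges of `M` on the cycle; `κ k` is the edge of `T \ M` from the white end of
  -- `k` to the black end of its successor `π k`.
  let ι : K → P.Edge := Subtype.val
  have hιM : ∀ k, ι k ∈ M := fun k => (hstep k).1
  choose κ hκM hκw hκb using fun k => (hstep k).2.2
  have hικ : ∀ k l, ι k ≠ κ l := fun k l h => (hκM l).2 (h ▸ hιM k)
  obtain ⟨A, B, hσAB, hτAB, hA, hsplit, heven⟩ := exists_region_of_cycle P.blackRot P.whiteRot
    P.blackEnd P.whiteEnd P.faceLeft P.blackEnd_blackRot P.whiteEnd_whiteRot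
    P.faceLeft_whiteRot_blackRot P.sameCycle_of_blackEnd_eq P.sameCycle_of_whiteEnd_eq
    P.eq_of_blackEnd_eq_whiteEnd P.eq_of_faceLeft_eq_faceLeft
    (by simpa only [Nat.card_eq_fintype_card] using P.euler_doubleGraph.le) none
    P.whiteRot_blackRot_involutive P.whiteRot_blackRot_ne ι κ π hπ hκb hκw
    (fun k l h => Subtype.ext (hM.blackEnd_inj _ (hιM k) _ (hιM l) h))
    (fun k l h => Subtype.ext (hM.whiteEnd_inj _ (hιM k) _ (hιM l) h)) hικ
  have hC : ∀ x, ¬ (x ∈ A ↔ x ∈ B) ↔ x ∈ Set.range ι ∨ x ∈ Set.range κ := by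
    intro x
    rcases hsplit with ⟨h1, h2⟩ | ⟨h1, h2⟩ <;> rw [h1, h2] <;> simp only [Set.mem_sdiff] <;> tauto
  have hιC : ∀ k, ι k ∈ A ∪ B := fun k => by
    have := (hC (ι k)).2 (Or.inl ⟨k, rfl⟩)
    simp only [Set.mem_union]
    tauto
  have hbl : ∀ x, ¬ (x ∈ A ↔ x ∈ B) → ∃ m ∈ M, m ∈ A ∪ B ∧ P.blackEnd m = P.blackEnd x := by
    intro x hx
    rcases (hC x).1 hx with ⟨k, rfl⟩ | ⟨k, rfl⟩
    · exact ⟨ι k, hιM k, hιC k, rfl⟩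
    · exact ⟨ι (π k), hιM _, hιC _, (hκb k).symm⟩
  have hwh : ∀ x, ¬ (x ∈ A ↔ x ∈ B) → ∃ k, P.whiteEnd (ι k) = P.whiteEnd x := by
    intro x hx
    rcases (hC x).1 hx with ⟨k, rfl⟩ | ⟨k, rfl⟩
    · exact ⟨k, rfl⟩
    · exact ⟨k, (hκw k).symm⟩
  rw [P.ncard_blackEnd_image_eq_ncard_whiteEnd_image hM hσAB hτAB hA hbl fun x hx => by
    obtain ⟨k, hk⟩ := hwh x hx
    exact ⟨ι k, hιM k, hιC k, hk⟩] at heven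
  have hlocal : ∀ x, (∀ y, P.whiteEnd y = P.whiteEnd x → (y ∈ A ↔ y ∈ B)) ∨
      ∀ y, P.whiteEnd y = P.whiteEnd x → (y ∈ T ↔ ¬ (y ∈ A ↔ y ∈ B)) := by
    intro x
    by_cases h : ∃ y, P.whiteEnd y = P.whiteEnd x ∧ ¬ (y ∈ A ↔ y ∈ B)
    · right
      obtain ⟨y, hyx, hy⟩ := h
      obtain ⟨k, hk⟩ := hwh y hy
      intro z hz
      have hzk : P.whiteEnd z = P.whiteEnd (ι k) := hz.trans (hk.trans hyx).symm
      rw [hC]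
      constructor
      · intro hzT
        by_cases hzM : z ∈ M
        · exact Or.inl ⟨k, hM.whiteEnd_inj _ (hιM k) _ hzM hzk.symm⟩
        · exact Or.inr ⟨k, eq_of_whiteEnd_eq_of_notMem hM hMT hT (hκM k) ⟨hzT, hzM⟩
            ((hκw k).trans hzk.symm)⟩
      · rintro (⟨l, rfl⟩ | ⟨l, rfl⟩)
        · exact hMT (hιM l)
        · exact (hκM l).1
    · left
      push Not at h
      exact h
  have hsum := P.sum_sectorWeight hτAB hT hA hlocal
  have hκi : Function.Injective κ := fun k l h => by
    have h1 := (hκw k).symm.trans ((congrArg P.whiteEnd h).trans (hκw l))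
    exact Subtype.ext (hM.whiteEnd_inj _ (hιM k) _ (hιM l) h1)
  -- Consecutive edges of the cycle share their black vertex, so the kinds of the incoming and
  -- outgoing edges have the same sum.
  have hkind : ∑ k, P.kind (P.blackEnd (κ k)) = ∑ k, P.kind (P.blackEnd (ι k)) := by
    rw [← Equiv.sum_comp π (fun k => P.kind (P.blackEnd (ι k)))]
    exact Finset.sum_congr rfl fun k _ => by rw [hκb k]
  have hA1 : ∑ x, (if x ∈ A then (1 : ZMod 4) else 0) = (A.ncard : ZMod 4) := by
    rw [Finset.sum_boole, ← Set.ncard_coe_finset]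
    simp
  have count : ∀ ι' κ' : K → P.Edge, Function.Injective ι' → Function.Injective κ' →
      Set.range ι' = A \ B → Set.range κ' = B \ A →
      ∑ k, P.kind (P.blackEnd (κ' k)) = ∑ k, P.kind (P.blackEnd (ι' k)) →
      (A.ncard : ZMod 4) = 2 * (Nat.card K : ZMod 4) := by
    intro ι' κ' hι' hκ' h1 h2 h3
    simp only [sectorWeight, ← Set.mem_sdiff, Finset.sum_sub_distrib,
      Finset.sum_add_distrib] at hsum
    rw [hA1] at hsum
    have e1 := sum_ite_mem_range_mul hι' (fun x => P.kind (P.blackEnd x) - 2)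
    have e2 := sum_ite_mem_range_mul hκ' (fun x => P.kind (P.blackEnd x))
    simp only [h1, h2] at e1 e2
    have e3 : (∑ k : K, (P.kind (P.blackEnd (ι' k)) - 2)) =
        ∑ k, P.kind (P.blackEnd (ι' k)) - 2 * (Nat.card K : ZMod 4) := by
      rw [Finset.sum_sub_distrib]
      simp [mul_comm]
    have e4 : (A.ncard : ZMod 4) + ∑ k : K, (P.kind (P.blackEnd (ι' k)) - 2) -
        ∑ k, P.kind (P.blackEnd (κ' k)) = 0 := by
      rw [← e1, ← e2]
      convert hsum using 3
    rw [e3, h3] at e4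
    linear_combination e4
  have hcard : (A.ncard : ZMod 4) = 2 * (Nat.card K : ZMod 4) := by
    rcases hsplit with ⟨h1, h2⟩ | ⟨h1, h2⟩
    · exact count ι κ Subtype.val_injective hκi h1 h2 hkind
    · exact count κ ι hκi Subtype.val_injective h1 h2 hkind.symm
  -- Halving, `A.ncard / 2` and the size of `K` have the same parity, whereas `heven`, with equal
  -- numbers of black and white vertices, makes their sum odd.
  have hmod : A.ncard % 4 = (2 * Nat.card K) % 4 := by
    rw [← ZMod.natCast_eq_natCast_iff']
    push_cast
    exact hcard
  rw [Nat.even_iff] at heven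
  omega

/-! ### The orientation and its tree property -/

/-- The orientation of a configuration `T` containing a matching `M`, in which the edges exiting
black vertices are those of `M`. -/
def orientation (M T : Set P.Edge) : Set (OrientedEdge P.doubleGraph) :=
  {a | (a.edge ∈ M ∧ a.src = P.blackEnd a.edge ∧ a.tgt = P.whiteEnd a.edge) ∨
    (a.edge ∈ T \ M ∧ a.src = P.whiteEnd a.edge ∧ a.tgt = P.blackEnd a.edge)}

theorem step_orientation_iff {v w : P.Vert} : Step (orientation M T) v w ↔
    (∃ e ∈ M, v = P.blackEnd e ∧ w = P.whiteEnd e) ∨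
      ∃ f ∈ T \ M, v = P.whiteEnd f ∧ w = P.blackEnd f := by
  constructor
  · rintro ⟨a, ⟨h1, h2, h3⟩ | ⟨h1, h2, h3⟩, rfl, rfl⟩
    · exact Or.inl ⟨a.edge, h1, h2, h3⟩
    · exact Or.inr ⟨a.edge, h1, h2, h3⟩
  · rintro (⟨e, he, rfl, rfl⟩ | ⟨e, he, rfl, rfl⟩)
    · exact ⟨⟨e, _, _, Or.inl ⟨rfl, rfl⟩⟩, Or.inl ⟨he, rfl, rfl⟩, rfl, rfl⟩
    · exact ⟨⟨e, _, _, Or.inr ⟨rfl, rfl⟩⟩, Or.inr ⟨he, rfl, rfl⟩, rfl, rfl⟩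

theorem unoriented_orientation (hMT : M ⊆ T) : unoriented (orientation M T) = T := by
  ext e
  constructor
  · rintro ⟨a, ⟨h, -⟩ | ⟨h, -⟩, rfl⟩
    · exact hMT h
    · exact h.1
  · intro he
    by_cases hM : e ∈ M
    · exact ⟨⟨e, _, _, Or.inl ⟨rfl, rfl⟩⟩, Or.inl ⟨hM, rfl, rfl⟩, rfl⟩
    · exact ⟨⟨e, _, _, Or.inr ⟨rfl, rfl⟩⟩, Or.inr ⟨⟨he, hM⟩, rfl, rfl⟩, rfl⟩

theorem blackOut_orientation : P.blackOut (orientation M T) = M := by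
  ext e
  constructor
  · rintro ⟨a, ⟨h, -⟩ | ⟨-, h, -⟩, hb, rfl⟩
    · exact h
    · exact absurd (h ▸ hb) (P.not_isBlack_whiteEnd _)
  · intro he
    exact ⟨⟨e, _, _, Or.inl ⟨rfl, rfl⟩⟩, Or.inl ⟨he, rfl, rfl⟩, P.isBlack_blackEnd e, rfl⟩

/-- Two steps of the orientation, from black to black, make one step of `Follows`. Tracking the edge
of `M` at either kind of end lets the induction pass through white vertices. -/
theorem reflTransGen_follows_of_step (hM : P.IsDimerAwayFrom (.boundaryDual s) M) {e : P.Edge}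
    (he : e ∈ M) {v : P.Vert}
    (h : Relation.ReflTransGen (Step (orientation M T)) (P.blackEnd e) v) :
    ∀ e' ∈ M, P.blackEnd e' = v ∨ P.whiteEnd e' = v →
      Relation.ReflTransGen (P.Follows M T) e e' := by
  induction h with
  | refl =>
    rintro e' he' (h | h)
    · rw [hM.blackEnd_inj e' he' e he h]
    · exact absurd h.symm (P.blackEnd_ne_whiteEnd _ _)
  | tail _ hstep ih =>
    rcases step_orientation_iff.1 hstep with ⟨m, hm, rfl, rfl⟩ | ⟨f, hf, rfl, rfl⟩
    · rintro e' he' (h | h)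
      · exact absurd h (P.blackEnd_ne_whiteEnd _ _)
      · rw [hM.whiteEnd_inj e' he' m hm h]
        exact ih m hm (Or.inl rfl)
    · rintro e' he' (h | h)
      · obtain ⟨m, hm, hmf⟩ := hM.exists_whiteEnd_eq f
        exact (ih m hm (Or.inr hmf)).tail ⟨hm, he', f, hf, hmf.symm, h.symm⟩
      · exact absurd h.symm (P.blackEnd_ne_whiteEnd _ _)

/-- An oriented cycle through a black vertex closes up as a chain of `Follows`; one through a white
vertex can be started at the black vertex preceded by its outgoing edge. -/
theorem not_transGen_step_orientation [Finite V] (hM : P.IsDimerAwayFrom (.boundaryDual s) M)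
    (hMT : M ⊆ T) (hT : P.SatisfiesLocal T) (v : P.Vert) :
    ¬ Relation.TransGen (Step (orientation M T)) v v := by
  have black : ∀ v, P.IsBlack v → ¬ Relation.TransGen (Step (orientation M T)) v v := by
    intro v hv h
    obtain ⟨w, hvw, -⟩ := Relation.TransGen.head'_iff.1 h
    obtain ⟨z, hz, hzv⟩ := Relation.TransGen.tail'_iff.1 h
    rcases step_orientation_iff.1 hvw with ⟨m, hm, rfl, -⟩ | ⟨f, -, rfl, -⟩
    · rcases step_orientation_iff.1 hzv with ⟨m', -, -, h'⟩ | ⟨f, hf, rfl, hfm⟩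
      · exact P.blackEnd_ne_whiteEnd _ _ h'
      · obtain ⟨m', hm', hmf⟩ := hM.exists_whiteEnd_eq f
        exact not_transGen_follows hM hMT hT m (Relation.TransGen.tail'
          (reflTransGen_follows_of_step hM hm hz m' hm' (Or.inr hmf))
          ⟨hm', hm, f, hf, hmf.symm, hfm.symm⟩)
    · exact P.not_isBlack_whiteEnd f hv
  by_cases hv : P.IsBlack v
  · exact black v hv
  · intro h
    obtain ⟨w, hvw, hwv⟩ := Relation.TransGen.head'_iff.1 h
    rcases step_orientation_iff.1 hvw with ⟨m, -, rfl, -⟩ | ⟨f, -, -, rfl⟩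
    · exact hv (P.isBlack_blackEnd m)
    · exact black _ (P.isBlack_blackEnd f) (Relation.TransGen.tail' hwv hvw)

theorem eq_whiteEnd_of_not_isBlack {v : P.Vert} (hv : ¬ P.IsBlack v) : ∃ x, P.whiteEnd x = v := by
  obtain ⟨x, rfl | h⟩ := P.exists_end_eq v
  · exact absurd (P.isBlack_blackEnd x) hv
  · exact ⟨x, h⟩

theorem isOST_orientation [Finite V] (hM : P.IsDimerAwayFrom (.boundaryDual s) M) (hMT : M ⊆ T)
    (hT : P.SatisfiesLocal T) :
    IsOST P.doubleGraph (.boundaryDual s) (orientation M T) where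
  root_mem := Set.mem_univ _
  exists_unique_out := by
    intro v _ hv
    by_cases hb : P.IsBlack v
    · obtain ⟨m, hm, rfl⟩ := hM.exists_blackEnd_eq v hb hv
      refine ⟨⟨m, _, _, Or.inl ⟨rfl, rfl⟩⟩, ⟨Or.inl ⟨hm, rfl, rfl⟩, rfl⟩, ?_⟩
      rintro ⟨e, v, w, hl⟩ ⟨⟨he, h1, h2⟩ | ⟨-, h1, -⟩, h3⟩
      · dsimp only at he h1 h2 h3
        obtain rfl := hM.blackEnd_inj e he m hm (h1.symm.trans h3)
        subst h1 h2
        rfl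
      · exact absurd (h3.symm.trans h1) (P.blackEnd_ne_whiteEnd _ _)
    · obtain ⟨x, rfl⟩ := eq_whiteEnd_of_not_isBlack hb
      obtain ⟨f, hf, hfx⟩ := exists_mem_diff_whiteEnd_eq hM hMT hT x
      refine ⟨⟨f, _, _, Or.inr ⟨rfl, rfl⟩⟩, ⟨Or.inr ⟨hf, rfl, rfl⟩, hfx⟩, ?_⟩
      rintro ⟨e, v, w, hl⟩ ⟨⟨-, h1, -⟩ | ⟨he, h1, h2⟩, h3⟩
      · exact absurd (h1.symm.trans h3) (P.blackEnd_ne_whiteEnd _ _)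
      · dsimp only at he h1 h2 h3
        obtain rfl := eq_of_whiteEnd_eq_of_notMem hM hMT hT he hf
          (h1.symm.trans (h3.trans hfx.symm))
        subst h1 h2
        rfl
  root_no_out := by
    rintro a (⟨h1, h2, -⟩ | ⟨-, h2, -⟩) h
    · exact hM.blackEnd_ne _ h1 (h2.symm.trans h)
    · exact P.not_isBlack_whiteEnd a.edge (h2.symm.trans h ▸ trivial)
  no_cycle := not_transGen_step_orientation hM hMT hT

end PlaneEmbedding

end ExtendedDouble

theorem proposition6p4 {V : Type*} [Fintype V] (G : SimpleGraph V) [DecidableRel G.Adj]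
    (hdeg : ∀ v, 2 ≤ G.degree v) (P : ExtendedDouble.PlaneEmbedding G)
    (s : P.BoundaryDart) (M T : Set P.Edge)
    (hM : ExtendedDouble.IsPerfectMatching (P.doubleGraphMinus (.boundaryDual s)) M)
    (hMT : M ⊆ T) (hT : P.SatisfiesLocal T) :
    ∃ O : Set (ExtendedDouble.OrientedEdge P.doubleGraph),
      P.IsCompatibleOST (.boundaryDual s) M O ∧ ExtendedDouble.unoriented O = T := by
  have hM' := P.isDimerAwayFrom_of_isPerfectMatching (s := .boundaryDual s) trivial hM
  have hO := ExtendedDouble.PlaneEmbedding.unoriented_orientation hMT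
  exact ⟨ExtendedDouble.PlaneEmbedding.orientation M T,
    ⟨ExtendedDouble.PlaneEmbedding.isOST_orientation hM' hMT hT, by rwa [hO],
      ExtendedDouble.PlaneEmbedding.blackOut_orientation⟩, hO⟩
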